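/- Let $n\ge 2$ and write $B_1$ for the open unit ball of $\mathbb{R}^n$. Let $\omega$ be a Muckenhoupt $A_2$ weight on $\mathbb{R}^n$, that is, a nonnegative measurable function such that $\omega$ and $\omega^{-1}$ are locally integrable and $$\sup_{B}\Big(\frac1{|B|}\int_B\omega\,dx\Big)\Big(\frac1{|B|}\int_B\omega^{-1}\,dx\Big)<\infty,$$ the supremum being over all balls $B\subset\mathbb{R}^n$. For measurable $E$ put $\omega(E)=\int_E\omega\,dx$. Let $H^1(B_1,\omega)$ be the space of all $u\in L^2(B_1,\omega)$ whose weak gradient $\nabla u$ belongs to $L^2(B_1,\omega)$, let $H^1_0(B_1,\omega)$ be the closure of $C_c^\infty(B_1)$ in $H^1(B_1,\omega)$, and, for $g\in C^\infty(\overline{B_1})$, let $H^1_g(B_1,\omega)$ be the set of all $u\in H^1(B_1,\omega)$ with $u-g\in H^1_0(B_1,\omega)$. Fix $g\in C^\infty(\overline{B_1})$ with $g\ge c$ on $\partial B_1$ for some constant $c>0$, and let $0<m<\omega(B_1)$ and $\varepsilon>0$. Consider the penalized problem $$(P_\varepsilon)\qquad \min\big\{J_\varepsilon(v): v\in H^1_g(B_1,\omega)\big\},\qquad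 J_\varepsilon(v)=\int_{B_1}|\nabla v|^2\,\omega\,dx+\frac1\varepsilon\big(\omega(\{v>0\}\cap B_1)-m\big)^+ .$$ 1. There is a minimizer $u$ of $(P_\varepsilon)$ with $u\ge 0$ a.e. in $B_1$. 2. Every minimizer $u$ of $(P_\varepsilon)$ with $u\ge0$ a.e. in $B_1$ satisfies $\mathrm{div}(\omega\nabla u)\ge 0$ in the weak sense in $B_1$, that is, $$\int_{B_1}\omega\,\nabla u\cdot\nabla\varphi\,dx\le 0\qquad\text{for all }\varphi\in H^1_0(B_1,\omega)\text{ with }\varphi\ge 0 \text{ a.e. in } B_1,$$ and $$0\le u\le \|g\|_{L^\infty(\partial B_1)}\qquad\text{a.e. in } B_1.$$ -/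

import Mathlib

open MeasureTheory Metric Filter
open scoped ContDiff ENNReal RealInnerProductSpace

noncomputable section

/-- A Muckenhoupt `A₂` weight `w` on `ℝⁿ`. Positivity almost everywhere is part of local integrability
of `w⁻¹` when `0⁻¹ = ∞`; it is a separate field because `0⁻¹ = 0` in `ℝ`. -/
structure IsA2Weight {n : ℕ} (w : EuclideanSpace ℝ (Fin n) → ℝ) : Prop where
  measurable : Measurable w
  nonneg : ∀ x, 0 ≤ w x
  pos_ae : ∀ᵐ x, 0 < w x
  locallyIntegrable : LocallyIntegrable w volume
  locallyIntegrable_inv : LocallyIntegrable (fun x => (w x)⁻¹) volume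
  bounded : ∃ C : ℝ, ∀ (z : EuclideanSpace ℝ (Fin n)) (r : ℝ), 0 < r →
    (⨍ x in ball z r, w x) * (⨍ x in ball z r, (w x)⁻¹) ≤ C

/-- The measure `w(E) = ∫_E w dx`. -/
def weightMeasure {n : ℕ} (w : EuclideanSpace ℝ (Fin n) → ℝ) :
    Measure (EuclideanSpace ℝ (Fin n)) :=
  volume.withDensity (fun x => ENNReal.ofReal (w x))

/-- The measure `w dx` on the unit ball `B₁`. -/
def weightMeasureBall {n : ℕ} (w : EuclideanSpace ℝ (Fin n) → ℝ) :
    Measure (EuclideanSpace ℝ (Fin n)) :=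
  (weightMeasure w).restrict (ball 0 1)

/-- `φ ∈ C_c^∞(B₁)`, extended by zero to `ℝⁿ`. -/
structure IsTestFunction {n : ℕ} (φ : EuclideanSpace ℝ (Fin n) → ℝ) : Prop where
  contDiff : ContDiff ℝ ∞ φ
  hasCompactSupport : HasCompactSupport φ
  tsupport_subset : tsupport φ ⊆ ball 0 1

/-- `G` is a weak gradient of `u` in `B₁`. Only the values in `B₁` matter. -/
structure HasWeakGrad {n : ℕ} (u : EuclideanSpace ℝ (Fin n) → ℝ)
    (G : EuclideanSpace ℝ (Fin n) → EuclideanSpace ℝ (Fin n)) : Prop where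
  locallyIntegrableOn : LocallyIntegrableOn u (ball 0 1) volume
  locallyIntegrableOn_grad : LocallyIntegrableOn G (ball 0 1) volume
  integral_eq : ∀ φ : EuclideanSpace ℝ (Fin n) → ℝ, IsTestFunction φ →
    ∀ e : EuclideanSpace ℝ (Fin n),
      ∫ x in ball 0 1, u x * fderiv ℝ φ x e = - ∫ x in ball 0 1, ⟪G x, e⟫ * φ x

open Classical in
/-- The weak gradient `∇u` in `B₁`, unique up to a null set of `B₁` when it exists
(and `0` when it does not). -/
def weakGrad {n : ℕ} (u : EuclideanSpace ℝ (Fin n) → ℝ) :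
    EuclideanSpace ℝ (Fin n) → EuclideanSpace ℝ (Fin n) :=
  if h : ∃ G, HasWeakGrad u G then h.choose else 0

/-- `u ∈ H¹(B₁, w)`. -/
structure MemH1 {n : ℕ} (w u : EuclideanSpace ℝ (Fin n) → ℝ) : Prop where
  memLp : MemLp u 2 (weightMeasureBall w)
  hasWeakGrad : HasWeakGrad u (weakGrad u)
  memLp_grad : MemLp (weakGrad u) 2 (weightMeasureBall w)

/-- The norm `‖u‖_{L²(B₁, w)} + ‖∇u‖_{L²(B₁, w)}` of `H¹(B₁, w)`. -/
def h1Norm {n : ℕ} (w u : EuclideanSpace ℝ (Fin n) → ℝ) : ℝ≥0∞ :=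
  eLpNorm u 2 (weightMeasureBall w) + eLpNorm (weakGrad u) 2 (weightMeasureBall w)

/-- `u ∈ H¹₀(B₁, w)`, the closure of `C_c^∞(B₁)` in `H¹(B₁, w)`. -/
def MemH10 {n : ℕ} (w u : EuclideanSpace ℝ (Fin n) → ℝ) : Prop :=
  MemH1 w u ∧ ∀ δ : ℝ≥0∞, 0 < δ →
    ∃ φ : EuclideanSpace ℝ (Fin n) → ℝ, IsTestFunction φ ∧ h1Norm w (fun x => u x - φ x) < δ

/-- `u ∈ H¹_g(B₁, w)`. -/
def MemH1g {n : ℕ} (w g u : EuclideanSpace ℝ (Fin n) → ℝ) : Prop :=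
  MemH1 w u ∧ MemH10 w (fun x => u x - g x)

/-- The penalty `f_ε(t) = (t - m)⁺ / ε`. -/
def penalty (ε m t : ℝ) : ℝ := (1 / ε) * max (t - m) 0

/-- `J_ε(v, w, B₁) = ∫_{B₁} |∇v|² w dx + f_ε(w({v > 0} ∩ B₁))`. -/
def penalizedEnergy {n : ℕ} (ε m : ℝ) (w v : EuclideanSpace ℝ (Fin n) → ℝ) : ℝ :=
  (∫ x in ball 0 1, ‖weakGrad v x‖ ^ 2 * w x) +
    penalty ε m ((weightMeasure w).real ({x | 0 < v x} ∩ ball 0 1))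

/-- `u` minimizes `J_ε(·, w, B₁)` over `H¹_g(B₁, w)`. -/
def IsPenalizedMinimizer {n : ℕ} (ε m : ℝ) (w g u : EuclideanSpace ℝ (Fin n) → ℝ) : Prop :=
  MemH1g w g u ∧ ∀ v : EuclideanSpace ℝ (Fin n) → ℝ, MemH1g w g v →
    penalizedEnergy ε m w u ≤ penalizedEnergy ε m w v

/-- `div(w ∇u) ≥ 0` in `B₁` in the weak sense. The test functions are the nonnegative elements of
`H¹₀(B₁, w)`; those of `C_c^∞(B₁)` are among them. -/
def IsWeakSubsolution {n : ℕ} (w u : EuclideanSpace ℝ (Fin n) → ℝ) : Prop :=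
  MemH1 w u ∧ ∀ φ : EuclideanSpace ℝ (Fin n) → ℝ, MemH10 w φ →
    (∀ᵐ x ∂(volume.restrict (ball 0 1)), 0 ≤ φ x) →
    ∫ x in ball 0 1, w x * ⟪weakGrad u x, weakGrad φ x⟫ ≤ 0

/-- `‖g‖_{L^∞(∂B₁)}`, for `g` continuous on the unit sphere. -/
def boundarySup {n : ℕ} (g : EuclideanSpace ℝ (Fin n) → ℝ) : ℝ :=
  sSup ((fun x => |g x|) '' sphere 0 1)

end

/-! Existence is the direct method. Clipping a competitor to `[0, ‖g‖_∞]` raises neither the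
Dirichlet energy nor the measure of the positivity set, so a minimizing sequence may be taken
between these bounds. It is then bounded in `H¹(B₁, w)`, since `w(B₁) < ∞`. A subsequence converges
weakly, with its gradients, and almost everywhere. The Dirichlet energy is weakly lower
semicontinuous. The penalty is a continuous nondecreasing function of `w({v > 0})`, and that measure
is lower semicontinuous under a.e. convergence.

For the subsolution property compare `u` with `u - tφ`, where `φ ≥ 0` and `t > 0`. The positivity
set can only shrink, so only the Dirichlet term matters, and `t → 0` gives the sign. The upper bound
is the maximum principle: testing with `(u - M)⁺`, `M = ‖g‖_∞`, shows that its gradient vanishes,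
and an element of `H¹₀` with zero gradient is zero.

The weight is handled by one inequality, `‖f‖_{L¹(B₁)} ≤ ‖w⁻¹‖_{L²(w)} ‖f‖_{L²(w)}`
(`IsA2Weight.eLpNorm_one_le`). It reduces the Poincaré inequality and the compactness to unweighted
facts about `W^{1,1}_0(B₁)`, and makes weak gradients stable under `L²(w)` limits. The other
supports are the chain rule `MemH10Pair.smooth_comp` with its consequence `MemH10Pair.min_const`,
the compactness results `exists_subseq_tendsto_memH10Pair` and `tendsto_eLpNorm_one_of_memH10Pair`,
and the semicontinuity `penalty_le_of_ae_tendsto`.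

Since `weakGrad` is a choice, most arguments carry an explicit gradient `G` beside `u`
(`MemH10Pair`) and return to `weakGrad` only through a.e. uniqueness. -/

open scoped Topology Gradient

/-! ### The weighted measure on the ball and the embedding `L²(B₁, w) ⊂ L¹(B₁)`. -/

section Weight

variable {n : ℕ} {w : EuclideanSpace ℝ (Fin n) → ℝ}

theorem weightMeasureBall_eq_withDensity (w : EuclideanSpace ℝ (Fin n) → ℝ) :
    weightMeasureBall w =
      (volume.restrict (ball 0 1)).withDensity (fun x => ENNReal.ofReal (w x)) :=
  restrict_withDensity measurableSet_ball _

theorem MeasureTheory.LocallyIntegrable.integrableOn_ball {F : Type*} [NormedAddCommGroup F]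
    {f : EuclideanSpace ℝ (Fin n) → F} (hf : LocallyIntegrable f volume) :
    IntegrableOn f (ball 0 1) volume :=
  (hf.integrableOn_isCompact (isCompact_closedBall 0 1)).mono_set ball_subset_closedBall

theorem IsA2Weight.isFiniteMeasure (hw : IsA2Weight w) : IsFiniteMeasure (weightMeasureBall w) := by
  rw [weightMeasureBall_eq_withDensity]
  apply isFiniteMeasure_withDensity_ofReal
  exact hw.locallyIntegrable.integrableOn_ball.2

/-- Since `w > 0` a.e., the density kills no set of positive Lebesgue measure. This allows a.e.
statements and measurability to pass freely between the two measures. -/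
theorem IsA2Weight.ae_eq (hw : IsA2Weight w) :
    ae (weightMeasureBall w) = ae (volume.restrict (ball 0 1)) := by
  rw [weightMeasureBall_eq_withDensity]
  apply le_antisymm
  · exact (withDensity_absolutelyContinuous _ _).ae_le
  · refine (withDensity_absolutelyContinuous' hw.measurable.ennreal_ofReal.aemeasurable ?_).ae_le
    filter_upwards [ae_restrict_of_ae hw.pos_ae] with x hx
    simpa using hx

theorem IsA2Weight.aestronglyMeasurable_iff (hw : IsA2Weight w) {F : Type*} [TopologicalSpace F]
    {f : EuclideanSpace ℝ (Fin n) → F} :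
    AEStronglyMeasurable f (weightMeasureBall w) ↔
      AEStronglyMeasurable f (volume.restrict (ball 0 1)) := by
  constructor <;> intro h
  · exact h.mono_ac (fun s hs => by
      have : sᶜ ∈ ae (weightMeasureBall w) := by simpa [mem_ae_iff] using hs
      rw [hw.ae_eq] at this; simpa [mem_ae_iff] using this)
  · exact h.mono_ac (fun s hs => by
      have : sᶜ ∈ ae (volume.restrict (ball 0 1)) := by simpa [mem_ae_iff] using hs
      rw [← hw.ae_eq] at this; simpa [mem_ae_iff] using this)

theorem IsA2Weight.lintegral_eq (hw : IsA2Weight w) (f : EuclideanSpace ℝ (Fin n) → ℝ≥0∞) :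
    ∫⁻ x, f x ∂(weightMeasureBall w) = ∫⁻ x in ball 0 1, ENNReal.ofReal (w x) * f x := by
  rw [weightMeasureBall_eq_withDensity,
    lintegral_withDensity_eq_lintegral_mul_non_measurable _ hw.measurable.ennreal_ofReal]
  · rfl
  · simp

theorem IsA2Weight.integral_eq (hw : IsA2Weight w) (f : EuclideanSpace ℝ (Fin n) → ℝ) :
    ∫ x, f x ∂(weightMeasureBall w) = ∫ x in ball 0 1, w x * f x := by
  rw [weightMeasureBall_eq_withDensity, integral_withDensity_eq_integral_toReal_smul
    hw.measurable.ennreal_ofReal (by simp)]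
  congr 1
  ext x
  simp [ENNReal.toReal_ofReal (hw.nonneg x)]

/-- The square of `w⁻¹` against `w dx` is `w⁻¹ dx`, which is finite on the ball. -/
theorem IsA2Weight.memLp_inv (hw : IsA2Weight w) :
    MemLp (fun x => (w x)⁻¹) 2 (weightMeasureBall w) := by
  refine ⟨hw.measurable.inv.aestronglyMeasurable, ?_⟩
  rw [eLpNorm_lt_top_iff_lintegral_rpow_enorm_lt_top (by simp) (by simp), hw.lintegral_eq]
  refine lt_of_le_of_lt (lintegral_mono_ae ?_) hw.locallyIntegrable_inv.integrableOn_ball.2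
  filter_upwards [ae_restrict_of_ae hw.pos_ae] with x hx
  rw [← ofReal_norm, Real.norm_of_nonneg (by positivity), ENNReal.ofReal_rpow_of_nonneg
    (by positivity) (by simp), ← ENNReal.ofReal_mul hx.le]
  apply ENNReal.ofReal_le_ofReal
  simp only [ENNReal.toReal_ofNat, Real.rpow_ofNat]
  apply le_of_eq
  field_simp

/-- Cauchy–Schwarz in `L²(w)` applied to `∫ |f| dx = ∫ w⁻¹ |f| w dx`. This is the bridge from
weighted to unweighted estimates. -/
theorem IsA2Weight.eLpNorm_one_le (hw : IsA2Weight w) {F : Type*} [NormedAddCommGroup F]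
    {f : EuclideanSpace ℝ (Fin n) → F} (hf : AEStronglyMeasurable f (weightMeasureBall w)) :
    eLpNorm f 1 (volume.restrict (ball 0 1)) ≤
      eLpNorm (fun x => (w x)⁻¹) 2 (weightMeasureBall w) * eLpNorm f 2 (weightMeasureBall w) := by
  have h1 : eLpNorm f 1 (volume.restrict (ball 0 1)) =
      eLpNorm (fun x => (w x)⁻¹ * ‖f x‖) 1 (weightMeasureBall w) := by
    rw [eLpNorm_one_eq_lintegral_enorm, eLpNorm_one_eq_lintegral_enorm, hw.lintegral_eq]
    refine lintegral_congr_ae ?_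
    filter_upwards [ae_restrict_of_ae hw.pos_ae] with x hx
    rw [← ofReal_norm, ← ofReal_norm, ← ENNReal.ofReal_mul hx.le, norm_mul,
      norm_norm, norm_inv, Real.norm_of_nonneg hx.le, mul_inv_cancel_left₀ hx.ne']
  rw [h1, ← eLpNorm_norm f]
  have h2 := eLpNorm_smul_le_mul_eLpNorm (p := 2) (q := 2) (r := 1) (f := fun x => ‖f x‖)
    (φ := fun x => (w x)⁻¹) hf.norm hw.measurable.inv.aestronglyMeasurable
  exact h2

theorem IsA2Weight.integrableOn (hw : IsA2Weight w) {F : Type*} [NormedAddCommGroup F]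
    {f : EuclideanSpace ℝ (Fin n) → F} (hf : MemLp f 2 (weightMeasureBall w)) :
    IntegrableOn f (ball 0 1) volume := by
  rw [IntegrableOn, ← memLp_one_iff_integrable]
  refine ⟨hw.aestronglyMeasurable_iff.1 hf.1, (hw.eLpNorm_one_le hf.1).trans_lt ?_⟩
  exact ENNReal.mul_lt_top hw.memLp_inv.2 hf.2

/-- If `fₖ → f` in `L²(B₁, w)`, then `∫ fₖ h → ∫ f h` for bounded `h`. -/
theorem IsA2Weight.tendsto_setIntegral_mul (hw : IsA2Weight w)
    {f : EuclideanSpace ℝ (Fin n) → ℝ} {F : ℕ → EuclideanSpace ℝ (Fin n) → ℝ}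
    (hf : MemLp f 2 (weightMeasureBall w)) (hF : ∀ k, MemLp (F k) 2 (weightMeasureBall w))
    (h : Tendsto (fun k => eLpNorm (fun x => F k x - f x) 2 (weightMeasureBall w)) atTop (𝓝 0))
    {η : EuclideanSpace ℝ (Fin n) → ℝ} (hη : Measurable η) {C : ℝ} (hC : ∀ x, ‖η x‖ ≤ C) :
    Tendsto (fun k => ∫ x in ball 0 1, F k x * η x) atTop (𝓝 (∫ x in ball 0 1, f x * η x)) := by
  have hint : ∀ f : EuclideanSpace ℝ (Fin n) → ℝ, MemLp f 2 (weightMeasureBall w) →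
      Integrable (fun x => f x * η x) (volume.restrict (ball 0 1)) := fun f hf =>
    (hw.integrableOn hf).mul_bdd hη.aestronglyMeasurable (ae_of_all _ hC)
  refine tendsto_integral_of_L1 _ (hint f hf).1 (Eventually.of_forall fun k => hint _ (hF k)) ?_
  have hbd : ∀ k, ∫⁻ x in ball 0 1, ‖F k x * η x - f x * η x‖ₑ ≤
      ENNReal.ofReal C * (eLpNorm (fun x => (w x)⁻¹) 2 (weightMeasureBall w) *
        eLpNorm (fun x => F k x - f x) 2 (weightMeasureBall w)) := by
    intro k
    refine le_trans ?_ (mul_le_mul_right (hw.eLpNorm_one_le ((hF k).sub hf).1) _)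
    rw [eLpNorm_one_eq_lintegral_enorm, ← lintegral_const_mul' _ _ ENNReal.ofReal_ne_top]
    refine lintegral_mono fun x => ?_
    rw [← sub_mul, enorm_mul, mul_comm]
    refine mul_le_mul' ?_ le_rfl
    rw [← ofReal_norm]
    exact ENNReal.ofReal_le_ofReal (hC x)
  refine tendsto_of_tendsto_of_tendsto_of_le_of_le tendsto_const_nhds ?_ (fun _ => zero_le) hbd
  have h2 : Tendsto (fun k => ENNReal.ofReal C * (eLpNorm (fun x => (w x)⁻¹) 2 (weightMeasureBall w) *
        eLpNorm (fun x => F k x - f x) 2 (weightMeasureBall w))) atTop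
      (𝓝 (ENNReal.ofReal C * (eLpNorm (fun x => (w x)⁻¹) 2 (weightMeasureBall w) * 0))) :=
    ENNReal.Tendsto.const_mul (ENNReal.Tendsto.const_mul h (Or.inr hw.memLp_inv.2.ne))
      (Or.inr ENNReal.ofReal_ne_top)
  simpa using h2

end Weight

/-! ### Calculus of test functions. -/

section TestFunction

variable {n : ℕ} {φ ψ f : EuclideanSpace ℝ (Fin n) → ℝ}

theorem inner_gradient (f : EuclideanSpace ℝ (Fin n) → ℝ) (x e : EuclideanSpace ℝ (Fin n)) :
    ⟪∇ f x, e⟫ = fderiv ℝ f x e :=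
  InnerProductSpace.toDual_symm_apply

theorem norm_gradient (f : EuclideanSpace ℝ (Fin n) → ℝ) (x : EuclideanSpace ℝ (Fin n)) :
    ‖∇ f x‖ = ‖fderiv ℝ f x‖ :=
  LinearIsometryEquiv.norm_map _ _

theorem ContinuousOn.gradient {s : Set (EuclideanSpace ℝ (Fin n))}
    (hf : ContinuousOn (fderiv ℝ f) s) : ContinuousOn (∇ f) s :=
  (LinearIsometryEquiv.continuous _).comp_continuousOn hf

theorem IsTestFunction.differentiable (hφ : IsTestFunction φ) : Differentiable ℝ φ :=
  hφ.contDiff.differentiable (by simp)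

theorem IsTestFunction.continuous_fderiv (hφ : IsTestFunction φ) : Continuous (fderiv ℝ φ) :=
  hφ.contDiff.continuous_fderiv (by simp)

theorem IsTestFunction.continuous_gradient (hφ : IsTestFunction φ) : Continuous (∇ φ) :=
  (LinearIsometryEquiv.continuous _).comp hφ.continuous_fderiv

theorem IsTestFunction.hasCompactSupport_gradient (hφ : IsTestFunction φ) :
    HasCompactSupport (∇ φ) :=
  (hφ.hasCompactSupport.fderiv ℝ).comp_left (g := (InnerProductSpace.toDual ℝ _).symm) (map_zero _)

theorem IsTestFunction.eq_zero (hφ : IsTestFunction φ) {x : EuclideanSpace ℝ (Fin n)}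
    (hx : x ∉ ball (0 : EuclideanSpace ℝ (Fin n)) 1) : φ x = 0 :=
  image_eq_zero_of_notMem_tsupport fun h => hx (hφ.tsupport_subset h)

theorem IsTestFunction.fderiv_eq_zero (hφ : IsTestFunction φ) {x : EuclideanSpace ℝ (Fin n)}
    (hx : x ∉ ball (0 : EuclideanSpace ℝ (Fin n)) 1) : fderiv ℝ φ x = 0 :=
  image_eq_zero_of_notMem_tsupport fun h => hx (hφ.tsupport_subset (tsupport_fderiv_subset ℝ h))

theorem isTestFunction_zero : IsTestFunction (fun _ : EuclideanSpace ℝ (Fin n) => (0 : ℝ)) :=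
  ⟨contDiff_const, HasCompactSupport.zero, by
    have : tsupport (fun _ : EuclideanSpace ℝ (Fin n) => (0 : ℝ)) = ∅ :=
      tsupport_eq_empty_iff.2 rfl
    simp [this]⟩

theorem IsTestFunction.add (hφ : IsTestFunction φ) (hψ : IsTestFunction ψ) :
    IsTestFunction (fun x => φ x + ψ x) :=
  ⟨hφ.contDiff.add hψ.contDiff, hφ.hasCompactSupport.add hψ.hasCompactSupport,
    (tsupport_add φ ψ).trans (Set.union_subset hφ.tsupport_subset hψ.tsupport_subset)⟩

theorem IsTestFunction.const_mul (hφ : IsTestFunction φ) (c : ℝ) :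
    IsTestFunction (fun x => c * φ x) :=
  ⟨contDiff_const.mul hφ.contDiff, hφ.hasCompactSupport.mul_left,
    (tsupport_mul_subset_right (f := fun _ => c)).trans hφ.tsupport_subset⟩

theorem gradient_add_apply {x : EuclideanSpace ℝ (Fin n)} (hφ : DifferentiableAt ℝ φ x)
    (hψ : DifferentiableAt ℝ ψ x) : ∇ (fun y => φ y + ψ y) x = ∇ φ x + ∇ ψ x := by
  simp only [gradient, fderiv_fun_add hφ hψ, map_add]

theorem gradient_const_mul_apply {x : EuclideanSpace ℝ (Fin n)} (hφ : DifferentiableAt ℝ φ x)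
    (c : ℝ) : ∇ (fun y => c * φ y) x = c • ∇ φ x := by
  simp only [gradient, fderiv_const_mul hφ, map_smul]

theorem MeasureTheory.LocallyIntegrableOn.integrable_smul {F : Type*} [NormedAddCommGroup F]
    [NormedSpace ℝ F] {v : EuclideanSpace ℝ (Fin n) → F} {U : Set (EuclideanSpace ℝ (Fin n))}
    (hv : LocallyIntegrableOn v U volume) (hφ : Continuous φ) (hc : HasCompactSupport φ)
    (hs : tsupport φ ⊆ U) : Integrable (fun x => φ x • v x) volume := by
  have h1 : IntegrableOn (fun x => φ x • v x) (tsupport φ) volume :=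
    (hv.integrableOn_compact_subset hs hc).continuousOn_smul hφ.continuousOn hc
  refine (integrableOn_iff_integrable_of_support_subset ?_).1 h1
  intro x hx
  apply subset_tsupport φ
  intro h
  simp [h] at hx

end TestFunction

/-! ### Weak gradients: uniqueness, linearity, stability under limits. -/

section WeakGradient

variable {n : ℕ} {u v : EuclideanSpace ℝ (Fin n) → ℝ}
  {G H : EuclideanSpace ℝ (Fin n) → EuclideanSpace ℝ (Fin n)}

/-- The fundamental lemma of the calculus of variations, applied to `G - H` after pairing with each
constant vector `e`. It allows the chosen `weakGrad` to be replaced by any gradient computed by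
hand. -/
theorem HasWeakGrad.ae_eq (h : HasWeakGrad u G) (h' : HasWeakGrad u H) :
    G =ᵐ[volume.restrict (ball 0 1)] H := by
  have key : ∀ᵐ x, x ∈ ball (0 : EuclideanSpace ℝ (Fin n)) 1 → (G - H) x = 0 := by
    refine isOpen_ball.ae_eq_zero_of_integral_contDiff_smul_eq_zero
      (h.locallyIntegrableOn_grad.sub h'.locallyIntegrableOn_grad) fun φ h1 h2 h3 => ?_
    have hφ : IsTestFunction φ := ⟨h1, h2, h3⟩
    have hG := h.locallyIntegrableOn_grad.integrable_smul h1.continuous h2 h3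
    have hH := h'.locallyIntegrableOn_grad.integrable_smul h1.continuous h2 h3
    have hball : ∀ (K : EuclideanSpace ℝ (Fin n) → EuclideanSpace ℝ (Fin n))
        (e : EuclideanSpace ℝ (Fin n)), Integrable (fun x => φ x • K x) volume →
        ⟪e, ∫ x, φ x • K x⟫ = ∫ x in ball 0 1, ⟪K x, e⟫ * φ x := by
      intro K e hK
      rw [← integral_inner hK, setIntegral_eq_integral_of_forall_compl_eq_zero]
      · refine integral_congr_ae (ae_of_all _ fun x => ?_)
        simp only [inner_smul_right, real_inner_comm, mul_comm]
      · intro x hx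
        rw [hφ.eq_zero hx, mul_zero]
    simp only [Pi.sub_apply, smul_sub]
    rw [integral_sub hG hH]
    refine ext_inner_left ℝ fun e => ?_
    rw [inner_sub_right, hball G e hG, hball H e hH, inner_zero_right, sub_eq_zero, ← neg_inj,
      ← h.integral_eq φ hφ e, ← h'.integral_eq φ hφ e]
  rw [EventuallyEq, ae_restrict_iff' measurableSet_ball]
  filter_upwards [key] with x hx hxB using sub_eq_zero.1 (hx hxB)

theorem HasWeakGrad.hasWeakGrad_weakGrad (h : HasWeakGrad u G) : HasWeakGrad u (weakGrad u) := by
  have hex : ∃ G, HasWeakGrad u G := ⟨G, h⟩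
  rw [weakGrad, dif_pos hex]
  exact hex.choose_spec

theorem HasWeakGrad.weakGrad_ae_eq (h : HasWeakGrad u G) :
    weakGrad u =ᵐ[volume.restrict (ball 0 1)] G :=
  h.hasWeakGrad_weakGrad.ae_eq h

theorem HasWeakGrad.congr (h : HasWeakGrad u G) (hu : u =ᵐ[volume.restrict (ball 0 1)] v)
    (hG : G =ᵐ[volume.restrict (ball 0 1)] H) : HasWeakGrad v H where
  locallyIntegrableOn := h.locallyIntegrableOn.congr hu
  locallyIntegrableOn_grad := h.locallyIntegrableOn_grad.congr hG
  integral_eq φ hφ e := by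
    have h1 := h.integral_eq φ hφ e
    have h2 : ∫ x in ball 0 1, v x * fderiv ℝ φ x e = ∫ x in ball 0 1, u x * fderiv ℝ φ x e :=
      integral_congr_ae (by filter_upwards [hu] with x hx; rw [hx])
    have h3 : ∫ x in ball 0 1, ⟪H x, e⟫ * φ x = ∫ x in ball 0 1, ⟪G x, e⟫ * φ x :=
      integral_congr_ae (by filter_upwards [hG] with x hx; rw [hx])
    rw [h2, h3, h1]

theorem IsTestFunction.integrable_mul_fderiv {φ : EuclideanSpace ℝ (Fin n) → ℝ}
    (hφ : IsTestFunction φ) (hu : LocallyIntegrableOn u (ball 0 1) volume)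
    (e : EuclideanSpace ℝ (Fin n)) : Integrable (fun x => u x * fderiv ℝ φ x e) volume := by
  have hsub : tsupport (fun x => fderiv ℝ φ x e) ⊆ tsupport φ := tsupport_fderiv_apply_subset ℝ e
  have := hu.integrable_smul (φ := fun x => fderiv ℝ φ x e)
    (hφ.continuous_fderiv.clm_apply continuous_const)
    (hφ.hasCompactSupport.fderiv_apply ℝ e) (hsub.trans hφ.tsupport_subset)
  simpa only [smul_eq_mul, mul_comm] using this

theorem IsTestFunction.integrable_inner_mul {φ : EuclideanSpace ℝ (Fin n) → ℝ}
    (hφ : IsTestFunction φ) (hG : LocallyIntegrableOn G (ball 0 1) volume)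
    (e : EuclideanSpace ℝ (Fin n)) : Integrable (fun x => ⟪G x, e⟫ * φ x) volume := by
  have h := (hG.integrable_smul hφ.contDiff.continuous hφ.hasCompactSupport
    hφ.tsupport_subset).inner_const (𝕜 := ℝ) e
  simpa only [inner_smul_left, RCLike.conj_to_real, mul_comm] using h

theorem HasWeakGrad.add (hu : HasWeakGrad u G) (hv : HasWeakGrad v H) :
    HasWeakGrad (fun x => u x + v x) (fun x => G x + H x) where
  locallyIntegrableOn := hu.locallyIntegrableOn.add hv.locallyIntegrableOn
  locallyIntegrableOn_grad := hu.locallyIntegrableOn_grad.add hv.locallyIntegrableOn_grad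
  integral_eq φ hφ e := by
    simp only [add_mul, inner_add_left]
    rw [integral_add (hφ.integrable_mul_fderiv hu.locallyIntegrableOn e).integrableOn
        (hφ.integrable_mul_fderiv hv.locallyIntegrableOn e).integrableOn,
      integral_add (hφ.integrable_inner_mul hu.locallyIntegrableOn_grad e).integrableOn
        (hφ.integrable_inner_mul hv.locallyIntegrableOn_grad e).integrableOn,
      hu.integral_eq φ hφ e, hv.integral_eq φ hφ e, neg_add]

theorem HasWeakGrad.const_mul (hu : HasWeakGrad u G) (c : ℝ) :
    HasWeakGrad (fun x => c * u x) (fun x => c • G x) where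
  locallyIntegrableOn := hu.locallyIntegrableOn.smul c
  locallyIntegrableOn_grad := hu.locallyIntegrableOn_grad.smul c
  integral_eq φ hφ e := by
    simp only [mul_assoc, inner_smul_left, RCLike.conj_to_real]
    rw [integral_const_mul, integral_const_mul, hu.integral_eq φ hφ e, mul_neg]

theorem HasWeakGrad.sub (hu : HasWeakGrad u G) (hv : HasWeakGrad v H) :
    HasWeakGrad (fun x => u x - v x) (fun x => G x - H x) := by
  simpa [sub_eq_add_neg] using hu.add (hv.const_mul (-1))

theorem hasWeakGrad_gradient (hu : ContDiffOn ℝ 1 u (ball 0 1)) : HasWeakGrad u (∇ u) := by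
  have hd : ∀ x ∈ ball (0 : EuclideanSpace ℝ (Fin n)) 1, DifferentiableAt ℝ u x := fun x hx =>
    (hu.differentiableOn (by simp)).differentiableAt (isOpen_ball.mem_nhds hx)
  have h1 : LocallyIntegrableOn u (ball 0 1) volume :=
    hu.continuousOn.locallyIntegrableOn measurableSet_ball
  have h2 : LocallyIntegrableOn (∇ u) (ball 0 1) volume :=
    (ContinuousOn.gradient (hu.continuousOn_fderiv_of_isOpen isOpen_ball
      (by simp))).locallyIntegrableOn measurableSet_ball
  refine ⟨h1, h2, fun φ hφ e => ?_⟩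
  rw [setIntegral_eq_integral_of_forall_compl_eq_zero, setIntegral_eq_integral_of_forall_compl_eq_zero]
  · simp only [inner_gradient]
    have h3 := hφ.integrable_inner_mul h2 e
    simp only [inner_gradient] at h3
    refine integral_mul_fderiv_eq_neg_fderiv_mul_of_integrable h3
      (hφ.integrable_mul_fderiv h1 e) ?_ (fun x hx => hd x (hφ.tsupport_subset hx))
      (fun x _ => hφ.differentiable x)
    simpa only [smul_eq_mul, mul_comm] using
      h1.integrable_smul hφ.contDiff.continuous hφ.hasCompactSupport hφ.tsupport_subset
  · intro x hx
    rw [hφ.eq_zero hx, mul_zero]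
  · intro x hx
    simp [hφ.fderiv_eq_zero hx]

theorem IsTestFunction.hasWeakGrad {φ : EuclideanSpace ℝ (Fin n) → ℝ} (hφ : IsTestFunction φ) :
    HasWeakGrad φ (∇ φ) :=
  hasWeakGrad_gradient (hφ.contDiff.of_le (by simp)).contDiffOn

/-- Both sides of the integration by parts formula pair an `L²(w)` function with a bounded one, so
they are continuous along `L²(w)` convergence. -/
theorem IsA2Weight.hasWeakGrad_of_tendsto {w : EuclideanSpace ℝ (Fin n) → ℝ} (hw : IsA2Weight w)
    {U : ℕ → EuclideanSpace ℝ (Fin n) → ℝ}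
    {Γ : ℕ → EuclideanSpace ℝ (Fin n) → EuclideanSpace ℝ (Fin n)}
    (hu : MemLp u 2 (weightMeasureBall w)) (hG : MemLp G 2 (weightMeasureBall w))
    (hU : ∀ k, MemLp (U k) 2 (weightMeasureBall w)) (hΓ : ∀ k, MemLp (Γ k) 2 (weightMeasureBall w))
    (hUΓ : ∀ k, HasWeakGrad (U k) (Γ k))
    (h1 : Tendsto (fun k => eLpNorm (fun x => U k x - u x) 2 (weightMeasureBall w)) atTop (𝓝 0))
    (h2 : Tendsto (fun k => eLpNorm (fun x => Γ k x - G x) 2 (weightMeasureBall w)) atTop (𝓝 0)) :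
    HasWeakGrad u G where
  locallyIntegrableOn := (hw.integrableOn hu).locallyIntegrableOn
  locallyIntegrableOn_grad := (hw.integrableOn hG).locallyIntegrableOn
  integral_eq φ hφ e := by
    obtain ⟨C, hC⟩ := hφ.contDiff.continuous.bounded_above_of_compact_support hφ.hasCompactSupport
    have hce : Continuous (fun x => fderiv ℝ φ x e) := hφ.continuous_fderiv.clm_apply continuous_const
    obtain ⟨D, hD⟩ := hce.bounded_above_of_compact_support (hφ.hasCompactSupport.fderiv_apply ℝ e)
    have t1 := hw.tendsto_setIntegral_mul hu hU h1 hce.measurable hD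
    have h3 : Tendsto (fun k => eLpNorm (fun x => ⟪Γ k x, e⟫ - ⟪G x, e⟫) 2 (weightMeasureBall w))
        atTop (𝓝 0) := by
      have h4 : Tendsto (fun k => ENNReal.ofReal ‖e‖ *
          eLpNorm (fun x => Γ k x - G x) 2 (weightMeasureBall w)) atTop (𝓝 0) := by
        simpa using ENNReal.Tendsto.const_mul h2 (Or.inr (ENNReal.ofReal_ne_top (r := ‖e‖)))
      refine tendsto_of_tendsto_of_tendsto_of_le_of_le tendsto_const_nhds h4 (fun _ => zero_le)
        fun k => ?_
      refine eLpNorm_le_mul_eLpNorm_of_ae_le_mul (ae_of_all _ fun x => ?_) _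
      rw [← inner_sub_left, mul_comm]
      exact norm_inner_le_norm _ _
    have t2 := hw.tendsto_setIntegral_mul (hG.inner_const e) (fun k => (hΓ k).inner_const e) h3
      hφ.contDiff.continuous.measurable hC
    refine tendsto_nhds_unique t1 (t2.neg.congr fun k => ?_)
    rw [(hUΓ k).integral_eq φ hφ e]

end WeakGradient

/-! ### The space `H¹₀(B₁, w)` as a closed set of pairs (function, gradient). -/

/-- `(u, G)` lies in the closure of `{(φ, ∇φ) : φ ∈ C_c^∞(B₁)}` in `L²(B₁, w)`. -/
structure MemH10Pair {n : ℕ} (w u : EuclideanSpace ℝ (Fin n) → ℝ)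
    (G : EuclideanSpace ℝ (Fin n) → EuclideanSpace ℝ (Fin n)) : Prop where
  memLp : MemLp u 2 (weightMeasureBall w)
  memLp_grad : MemLp G 2 (weightMeasureBall w)
  approx : ∀ δ : ℝ≥0∞, 0 < δ → ∃ φ : EuclideanSpace ℝ (Fin n) → ℝ, IsTestFunction φ ∧
    eLpNorm (fun x => u x - φ x) 2 (weightMeasureBall w) +
      eLpNorm (fun x => G x - ∇ φ x) 2 (weightMeasureBall w) < δ

section MemH10Pair

variable {n : ℕ} {w u v g : EuclideanSpace ℝ (Fin n) → ℝ}
  {G H : EuclideanSpace ℝ (Fin n) → EuclideanSpace ℝ (Fin n)}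

theorem IsTestFunction.memLp (hw : IsA2Weight w) {φ : EuclideanSpace ℝ (Fin n) → ℝ}
    (hφ : IsTestFunction φ) : MemLp φ 2 (weightMeasureBall w) :=
  have := hw.isFiniteMeasure
  hφ.contDiff.continuous.memLp_of_hasCompactSupport hφ.hasCompactSupport

theorem IsTestFunction.memLp_gradient (hw : IsA2Weight w) {φ : EuclideanSpace ℝ (Fin n) → ℝ}
    (hφ : IsTestFunction φ) : MemLp (∇ φ) 2 (weightMeasureBall w) :=
  have := hw.isFiniteMeasure
  hφ.continuous_gradient.memLp_of_hasCompactSupport hφ.hasCompactSupport_gradient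

theorem IsTestFunction.memH10Pair (hw : IsA2Weight w) {φ : EuclideanSpace ℝ (Fin n) → ℝ}
    (hφ : IsTestFunction φ) : MemH10Pair w φ (∇ φ) :=
  ⟨hφ.memLp hw, hφ.memLp_gradient hw, fun δ hδ => ⟨φ, hφ, by simpa using hδ⟩⟩

/-- Triangle inequality for the sum of two `L²` seminorms. -/
theorem eLpNorm_add_eLpNorm_lt {α F K : Type*} [MeasurableSpace α] {μ : Measure α}
    [NormedAddCommGroup F] [NormedAddCommGroup K] {a a' : α → F} {b b' : α → K}
    (ha : AEStronglyMeasurable a μ) (ha' : AEStronglyMeasurable a' μ)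
    (hb : AEStronglyMeasurable b μ) (hb' : AEStronglyMeasurable b' μ) {δ : ℝ≥0∞}
    (h : eLpNorm a 2 μ + eLpNorm b 2 μ < δ / 2) (h' : eLpNorm a' 2 μ + eLpNorm b' 2 μ < δ / 2) :
    eLpNorm (fun x => a x + a' x) 2 μ + eLpNorm (fun x => b x + b' x) 2 μ < δ :=
  calc _ ≤ (eLpNorm a 2 μ + eLpNorm a' 2 μ) + (eLpNorm b 2 μ + eLpNorm b' 2 μ) :=
        add_le_add (eLpNorm_add_le ha ha' (by norm_num)) (eLpNorm_add_le hb hb' (by norm_num))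
    _ = (eLpNorm a 2 μ + eLpNorm b 2 μ) + (eLpNorm a' 2 μ + eLpNorm b' 2 μ) := by ring
    _ < δ / 2 + δ / 2 := ENNReal.add_lt_add h h'
    _ = δ := ENNReal.add_halves δ

theorem MemH10Pair.congr (h : MemH10Pair w u G) (hu : u =ᵐ[weightMeasureBall w] v)
    (hG : G =ᵐ[weightMeasureBall w] H) : MemH10Pair w v H where
  memLp := h.memLp.ae_eq hu
  memLp_grad := h.memLp_grad.ae_eq hG
  approx δ hδ := by
    obtain ⟨φ, hφ, h1⟩ := h.approx δ hδ
    refine ⟨φ, hφ, lt_of_eq_of_lt ?_ h1⟩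
    congr 1
    · exact eLpNorm_congr_ae (by filter_upwards [hu] with x hx; rw [hx])
    · exact eLpNorm_congr_ae (by filter_upwards [hG] with x hx; rw [hx])

theorem memH10Pair_zero (hw : IsA2Weight w) : MemH10Pair w (fun _ => 0) (fun _ => 0) := by
  have h := isTestFunction_zero.memH10Pair hw
  refine h.congr (ae_of_all _ fun _ => rfl) (ae_of_all _ fun x => ?_)
  simp [gradient]

/-- The closure is closed: half of `δ` goes to the approximating pair, half to a test function near
that pair. -/
theorem MemH10Pair.of_approx (hw : IsA2Weight w) (hu : MemLp u 2 (weightMeasureBall w))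
    (hG : MemLp G 2 (weightMeasureBall w))
    (h : ∀ δ : ℝ≥0∞, 0 < δ → ∃ v H, MemH10Pair w v H ∧
      eLpNorm (fun x => u x - v x) 2 (weightMeasureBall w) +
        eLpNorm (fun x => G x - H x) 2 (weightMeasureBall w) < δ) : MemH10Pair w u G := by
  refine ⟨hu, hG, fun δ hδ => ?_⟩
  obtain ⟨v, H, hv, h1⟩ := h (δ / 2) (ENNReal.half_pos hδ.ne')
  obtain ⟨φ, hφ, h2⟩ := hv.approx (δ / 2) (ENNReal.half_pos hδ.ne')
  refine ⟨φ, hφ, ?_⟩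
  have := eLpNorm_add_eLpNorm_lt (hu.sub hv.memLp).1 (hv.memLp.sub (hφ.memLp hw)).1
    (hG.sub hv.memLp_grad).1 (hv.memLp_grad.sub (hφ.memLp_gradient hw)).1 h1 h2
  simpa using this

theorem MemH10Pair.add (hw : IsA2Weight w) (hu : MemH10Pair w u G) (hv : MemH10Pair w v H) :
    MemH10Pair w (fun x => u x + v x) (fun x => G x + H x) := by
  refine ⟨hu.memLp.add hv.memLp, hu.memLp_grad.add hv.memLp_grad, fun δ hδ => ?_⟩
  obtain ⟨φ, hφ, h1⟩ := hu.approx (δ / 2) (ENNReal.half_pos hδ.ne')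
  obtain ⟨ψ, hψ, h2⟩ := hv.approx (δ / 2) (ENNReal.half_pos hδ.ne')
  refine ⟨_, hφ.add hψ, ?_⟩
  have := eLpNorm_add_eLpNorm_lt (hu.memLp.sub (hφ.memLp hw)).1 (hv.memLp.sub (hψ.memLp hw)).1
    (hu.memLp_grad.sub (hφ.memLp_gradient hw)).1 (hv.memLp_grad.sub (hψ.memLp_gradient hw)).1 h1 h2
  refine lt_of_eq_of_lt ?_ this
  congr 2
  · ext x; simp only [Pi.sub_apply]; ring
  · ext1 x
    rw [gradient_add_apply hφ.differentiable.differentiableAt hψ.differentiable.differentiableAt]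
    simp only [Pi.sub_apply]; abel

theorem MemH10Pair.const_mul (hu : MemH10Pair w u G) (c : ℝ) :
    MemH10Pair w (fun x => c * u x) (fun x => c • G x) := by
  refine ⟨hu.memLp.const_mul c, hu.memLp_grad.const_smul c, fun δ hδ => ?_⟩
  -- The `+ 1` keeps the divisor nonzero when `c = 0`.
  have hδ' : 0 < δ / (‖c‖ₑ + 1) := ENNReal.div_pos hδ.ne' (by simp)
  obtain ⟨φ, hφ, h1⟩ := hu.approx _ hδ'
  refine ⟨_, hφ.const_mul c, ?_⟩
  have e1 : (fun x => c * u x - c * φ x) = c • fun x => u x - φ x := by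
    ext x; simp [mul_sub]
  have e2 : (fun x => c • G x - ∇ (fun y => c * φ y) x) = c • fun x => G x - ∇ φ x := by
    ext1 x
    rw [gradient_const_mul_apply hφ.differentiable.differentiableAt, Pi.smul_apply, smul_sub]
  rw [e1, e2, eLpNorm_const_smul, eLpNorm_const_smul, ← mul_add]
  have h2 := (ENNReal.lt_div_iff_mul_lt (Or.inl (by simp)) (Or.inl (by simp))).1 h1
  refine lt_of_le_of_lt ?_ h2
  rw [mul_comm]
  gcongr
  exact le_self_add

theorem MemH10Pair.sub (hw : IsA2Weight w) (hu : MemH10Pair w u G) (hv : MemH10Pair w v H) :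
    MemH10Pair w (fun x => u x - v x) (fun x => G x - H x) := by
  simpa [sub_eq_add_neg] using hu.add hw (hv.const_mul (-1))

theorem MemH10Pair.exists_seq (hu : MemH10Pair w u G) :
    ∃ φ : ℕ → EuclideanSpace ℝ (Fin n) → ℝ, (∀ k, IsTestFunction (φ k)) ∧
      Tendsto (fun k => eLpNorm (fun x => φ k x - u x) 2 (weightMeasureBall w)) atTop (𝓝 0) ∧
      Tendsto (fun k => eLpNorm (fun x => ∇ (φ k) x - G x) 2 (weightMeasureBall w))
        atTop (𝓝 0) := by
  have hpos : ∀ k : ℕ, (0 : ℝ≥0∞) < ((k : ℝ≥0∞) + 1)⁻¹ := fun k => by simp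
  choose φ hφ h using fun k : ℕ => hu.approx _ (hpos k)
  have hlim : Tendsto (fun k : ℕ => ((k : ℝ≥0∞) + 1)⁻¹) atTop (𝓝 0) := by
    have := (tendsto_add_atTop_iff_nat 1).2 ENNReal.tendsto_inv_nat_nhds_zero
    simpa using this
  refine ⟨φ, hφ, ?_, ?_⟩
  · refine tendsto_of_tendsto_of_tendsto_of_le_of_le tendsto_const_nhds hlim (fun _ => zero_le)
      fun k => ?_
    refine le_trans ?_ (h k).le
    rw [show (fun x => φ k x - u x) = φ k - u from rfl, eLpNorm_sub_comm]
    exact le_self_add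
  · refine tendsto_of_tendsto_of_tendsto_of_le_of_le tendsto_const_nhds hlim (fun _ => zero_le)
      fun k => ?_
    refine le_trans ?_ (h k).le
    rw [show (fun x => ∇ (φ k) x - G x) = ∇ (φ k) - G from rfl, eLpNorm_sub_comm]
    exact le_add_self

theorem MemH10Pair.hasWeakGrad (hw : IsA2Weight w) (h : MemH10Pair w u G) : HasWeakGrad u G := by
  obtain ⟨φ, hφ, h1, h2⟩ := h.exists_seq
  exact hw.hasWeakGrad_of_tendsto h.memLp h.memLp_grad (fun k => (hφ k).memLp hw)
    (fun k => (hφ k).memLp_gradient hw) (fun k => (hφ k).hasWeakGrad) h1 h2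

theorem HasWeakGrad.weakGrad_ae_eq' (hw : IsA2Weight w) (h : HasWeakGrad u G) :
    weakGrad u =ᵐ[weightMeasureBall w] G := by
  rw [EventuallyEq, hw.ae_eq]
  exact h.weakGrad_ae_eq

theorem HasWeakGrad.memH1 (hw : IsA2Weight w) (h : HasWeakGrad u G)
    (hu : MemLp u 2 (weightMeasureBall w)) (hG : MemLp G 2 (weightMeasureBall w)) : MemH1 w u :=
  ⟨hu, h.hasWeakGrad_weakGrad, hG.ae_eq (h.weakGrad_ae_eq' hw).symm⟩

/-- With `MemH10.memH10Pair` this is the dictionary between pairs and `MemH10`. The norm of `u - φ`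
involves the chosen gradient of the difference, which agrees a.e. with `G - ∇φ`. -/
theorem MemH10Pair.memH10 (hw : IsA2Weight w) (h : MemH10Pair w u G) : MemH10 w u := by
  refine ⟨(h.hasWeakGrad hw).memH1 hw h.memLp h.memLp_grad, fun δ hδ => ?_⟩
  obtain ⟨φ, hφ, h1⟩ := h.approx δ hδ
  refine ⟨φ, hφ, ?_⟩
  rw [h1Norm, eLpNorm_congr_ae (((h.hasWeakGrad hw).sub hφ.hasWeakGrad).weakGrad_ae_eq' hw)]
  exact h1

theorem MemH10.memH10Pair (hw : IsA2Weight w) (h : MemH10 w u) : MemH10Pair w u (weakGrad u) := by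
  refine ⟨h.1.memLp, h.1.memLp_grad, fun δ hδ => ?_⟩
  obtain ⟨φ, hφ, h1⟩ := h.2 δ hδ
  refine ⟨φ, hφ, ?_⟩
  rwa [h1Norm, eLpNorm_congr_ae ((h.1.hasWeakGrad.sub hφ.hasWeakGrad).weakGrad_ae_eq' hw)] at h1

end MemH10Pair

/-! ### The affine space `H¹_g(B₁, w)` in terms of pairs. -/

section BoundaryDatum

variable {n : ℕ} {w u g : EuclideanSpace ℝ (Fin n) → ℝ}
  {G : EuclideanSpace ℝ (Fin n) → EuclideanSpace ℝ (Fin n)}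

theorem memLp_of_continuousOn_closedBall (hw : IsA2Weight w) {F : Type*} [NormedAddCommGroup F]
    {f : EuclideanSpace ℝ (Fin n) → F} (hf : ContinuousOn f (closedBall 0 1)) :
    MemLp f 2 (weightMeasureBall w) := by
  have := hw.isFiniteMeasure
  obtain ⟨C, hC⟩ := (isCompact_closedBall _ _).exists_bound_of_continuousOn hf
  refine MemLp.of_bound (hw.aestronglyMeasurable_iff.2
    ((hf.mono ball_subset_closedBall).aestronglyMeasurable measurableSet_ball)) C ?_
  rw [hw.ae_eq]
  exact (ae_restrict_mem measurableSet_ball).mono fun x hx => hC x (ball_subset_closedBall hx)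

theorem memLp_of_contDiffOn (hw : IsA2Weight w) (hg : ContDiffOn ℝ ∞ g (closedBall 0 1)) :
    MemLp g 2 (weightMeasureBall w) :=
  memLp_of_continuousOn_closedBall hw hg.continuousOn

theorem memLp_gradient_of_contDiffOn (hw : IsA2Weight w)
    (hg : ContDiffOn ℝ ∞ g (closedBall 0 1)) : MemLp (∇ g) 2 (weightMeasureBall w) := by
  -- Smoothness of `g` is only assumed on the closed ball, so `∇ g` need not be continuous up to the
  -- sphere. The derivative within the closed ball is continuous there, hence bounded, and agrees
  -- with the full derivative inside.
  have huniq : UniqueDiffOn ℝ (closedBall (0 : EuclideanSpace ℝ (Fin n)) 1) :=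
    uniqueDiffOn_convex (convex_closedBall _ _)
      ((nonempty_ball.2 one_pos).mono ball_subset_interior_closedBall)
  have h1 : MemLp (fun x => (InnerProductSpace.toDual ℝ (EuclideanSpace ℝ (Fin n))).symm
      (fderivWithin ℝ g (closedBall 0 1) x)) 2 (weightMeasureBall w) :=
    memLp_of_continuousOn_closedBall hw ((LinearIsometryEquiv.continuous _).comp_continuousOn
      (hg.continuousOn_fderivWithin huniq (by simp)))
  refine h1.ae_eq ?_
  rw [EventuallyEq, hw.ae_eq]
  refine (ae_restrict_mem measurableSet_ball).mono fun x hx => ?_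
  rw [gradient, fderivWithin_of_mem_nhds (closedBall_mem_nhds_of_mem hx)]

theorem hasWeakGrad_of_contDiffOn (hg : ContDiffOn ℝ ∞ g (closedBall 0 1)) :
    HasWeakGrad g (∇ g) :=
  hasWeakGrad_gradient ((hg.mono ball_subset_closedBall).of_le (by simp))

theorem MemH1g.memH10Pair (hw : IsA2Weight w) (hg : ContDiffOn ℝ ∞ g (closedBall 0 1))
    (hu : MemH1g w g u) :
    MemH10Pair w (fun x => u x - g x) (fun x => weakGrad u x - ∇ g x) :=
  (hu.2.memH10Pair hw).congr EventuallyEq.rfl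
    ((hu.1.hasWeakGrad.sub (hasWeakGrad_of_contDiffOn hg)).weakGrad_ae_eq' hw)

theorem MemH10Pair.hasWeakGrad_of_sub (hw : IsA2Weight w)
    (hg : ContDiffOn ℝ ∞ g (closedBall 0 1))
    (h : MemH10Pair w (fun x => u x - g x) (fun x => G x - ∇ g x)) : HasWeakGrad u G := by
  simpa using (h.hasWeakGrad hw).add (hasWeakGrad_of_contDiffOn hg)

theorem MemH10Pair.memLp_of_sub (hw : IsA2Weight w) (hg : ContDiffOn ℝ ∞ g (closedBall 0 1))
    (h : MemH10Pair w (fun x => u x - g x) (fun x => G x - ∇ g x)) :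
    MemLp u 2 (weightMeasureBall w) := by
  have := h.memLp.add (memLp_of_contDiffOn hw hg)
  exact this.ae_eq (ae_of_all _ fun x => by simp)

theorem MemH10Pair.memLp_grad_of_sub (hw : IsA2Weight w) (hg : ContDiffOn ℝ ∞ g (closedBall 0 1))
    (h : MemH10Pair w (fun x => u x - g x) (fun x => G x - ∇ g x)) :
    MemLp G 2 (weightMeasureBall w) := by
  have := h.memLp_grad.add (memLp_gradient_of_contDiffOn hw hg)
  exact this.ae_eq (ae_of_all _ fun x => by simp)

theorem MemH10Pair.memH1g (hw : IsA2Weight w) (hg : ContDiffOn ℝ ∞ g (closedBall 0 1))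
    (h : MemH10Pair w (fun x => u x - g x) (fun x => G x - ∇ g x)) : MemH1g w g u :=
  ⟨(h.hasWeakGrad_of_sub hw hg).memH1 hw (h.memLp_of_sub hw hg) (h.memLp_grad_of_sub hw hg),
    h.memH10 hw⟩

end BoundaryDatum

/-! ### Smooth approximations of `t ↦ min t a`. -/

section SmoothTruncation

/-- A smooth function equal to the identity on `(-∞, 0]` and constant on `[1, ∞)`. -/
noncomputable def smoothCap (t : ℝ) : ℝ := t - ∫ s in (0 : ℝ)..t, Real.smoothTransition s

theorem hasDerivAt_smoothCap (t : ℝ) :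
    HasDerivAt smoothCap (1 - Real.smoothTransition t) t :=
  (hasDerivAt_id t).sub (intervalIntegral.integral_hasDerivAt_right
    (Real.smoothTransition.continuous.intervalIntegrable _ _)
    Real.smoothTransition.continuous.stronglyMeasurable.stronglyMeasurableAtFilter
    Real.smoothTransition.continuousAt)

theorem contDiff_smoothCap : ContDiff ℝ ∞ smoothCap := by
  rw [contDiff_infty_iff_deriv]
  refine ⟨fun t => (hasDerivAt_smoothCap t).differentiableAt, ?_⟩
  rw [show deriv smoothCap = fun t => 1 - Real.smoothTransition t from
    funext fun t => (hasDerivAt_smoothCap t).deriv]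
  exact contDiff_const.sub Real.smoothTransition.contDiff

theorem smoothCap_of_nonpos {t : ℝ} (ht : t ≤ 0) : smoothCap t = t := by
  have : ∫ s in (0 : ℝ)..t, Real.smoothTransition s = ∫ s in (0 : ℝ)..t, (0 : ℝ) := by
    refine intervalIntegral.integral_congr fun s hs => ?_
    rw [Set.uIcc_of_ge ht] at hs
    exact Real.smoothTransition.zero_of_nonpos hs.2
  rw [smoothCap, this]
  simp

theorem smoothCap_nonneg {t : ℝ} (ht : 0 ≤ t) : 0 ≤ smoothCap t := by
  have : ∫ s in (0 : ℝ)..t, Real.smoothTransition s ≤ ∫ _ in (0 : ℝ)..t, (1 : ℝ) :=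
    intervalIntegral.integral_mono_on ht (Real.smoothTransition.continuous.intervalIntegrable _ _)
      intervalIntegrable_const fun s _ => Real.smoothTransition.le_one s
  rw [intervalIntegral.integral_const, smul_eq_mul, mul_one] at this
  rw [smoothCap]
  linarith

theorem smoothCap_le_one (t : ℝ) : smoothCap t ≤ 1 := by
  have hnn : ∀ {t : ℝ}, 0 ≤ t → 0 ≤ ∫ s in (0 : ℝ)..t, Real.smoothTransition s := fun ht =>
    intervalIntegral.integral_nonneg ht fun s _ => Real.smoothTransition.nonneg s
  rcases le_total t 0 with h0 | h0
  · rw [smoothCap_of_nonpos h0]; linarith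
  rcases le_total t 1 with h1 | h1
  · have := hnn h0
    rw [smoothCap]; linarith
  -- Beyond `1` the integrand equals `1`, so the growth of `t` cancels and `smoothCap t = 1 - ∫₀¹
  -- smoothTransition`.
  · have h2 : ∫ s in (1 : ℝ)..t, Real.smoothTransition s = ∫ s in (1 : ℝ)..t, (1 : ℝ) := by
      refine intervalIntegral.integral_congr fun s hs => ?_
      rw [Set.uIcc_of_le h1] at hs
      exact Real.smoothTransition.one_of_one_le hs.1
    have h3 := intervalIntegral.integral_add_adjacent_intervals (μ := volume)
      (Real.smoothTransition.continuous.intervalIntegrable 0 1)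
      (Real.smoothTransition.continuous.intervalIntegrable 1 t)
    rw [h2, intervalIntegral.integral_const, smul_eq_mul, mul_one] at h3
    have := hnn zero_le_one
    rw [smoothCap]; linarith

/-- A smooth approximation of `t ↦ min t a`, equal to the identity on `(-∞, a + δ]`. -/
noncomputable def smoothMin (a δ t : ℝ) : ℝ := a + δ + δ * smoothCap ((t - (a + δ)) / δ)

theorem hasDerivAt_smoothMin {a δ : ℝ} (hδ : 0 < δ) (t : ℝ) :
    HasDerivAt (smoothMin a δ) (1 - Real.smoothTransition ((t - (a + δ)) / δ)) t := by
  have h1 : HasDerivAt (fun t => (t - (a + δ)) / δ) (1 / δ) t :=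
    ((hasDerivAt_id t).sub_const _).div_const _
  have h2 := (((hasDerivAt_smoothCap _).comp t h1).const_mul δ).const_add (a + δ)
  convert! h2 using 1
  field_simp

theorem contDiff_smoothMin (a δ : ℝ) : ContDiff ℝ ∞ (smoothMin a δ) :=
  contDiff_const.add (contDiff_const.mul
    (contDiff_smoothCap.comp ((contDiff_id.sub contDiff_const).div_const _)))

theorem smoothMin_of_le {a δ t : ℝ} (hδ : 0 < δ) (ht : t ≤ a + δ) : smoothMin a δ t = t := by
  rw [smoothMin, smoothCap_of_nonpos (div_nonpos_of_nonpos_of_nonneg (by linarith) hδ.le)]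
  field_simp
  ring

theorem abs_smoothMin_sub_min_le {a δ : ℝ} (hδ : 0 < δ) (t : ℝ) :
    |smoothMin a δ t - min t a| ≤ 2 * δ := by
  rcases le_total t (a + δ) with h | h
  · rw [smoothMin_of_le hδ h, abs_le]
    rcases min_cases t a with ⟨h1, h2⟩ | ⟨h1, h2⟩ <;> rw [h1] <;> constructor <;> linarith
  · have h1 := smoothCap_nonneg (div_nonneg (sub_nonneg.2 h) hδ.le)
    have h2 := smoothCap_le_one ((t - (a + δ)) / δ)
    rw [smoothMin, min_eq_right (by linarith), abs_le]
    constructor <;> nlinarith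

/-- For `t ≤ a` the derivative is always `1`; for `t > a` it is `0` as soon as `a + 2δ ≤ t`, with `δ
= 1 / (j + 1)`. The limit exists at every `t`, the level `a` included, so the truncation needs no
separate argument that the gradient vanishes on `{u = a}`. -/
theorem tendsto_deriv_smoothMin (a t : ℝ) :
    Tendsto (fun j : ℕ => 1 - Real.smoothTransition
      ((t - (a + 1 / ((j : ℝ) + 1))) / (1 / ((j : ℝ) + 1)))) atTop
      (𝓝 (Set.indicator (Set.Iic a) (fun _ => (1 : ℝ)) t)) := by
  by_cases h : t ≤ a
  · rw [Set.indicator_of_mem (Set.mem_Iic.2 h)]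
    refine tendsto_const_nhds.congr fun j => ?_
    have : (0 : ℝ) < 1 / ((j : ℝ) + 1) := by positivity
    rw [Real.smoothTransition.zero_of_nonpos, sub_zero]
    exact div_nonpos_of_nonpos_of_nonneg (by linarith) this.le
  · rw [Set.indicator_of_notMem (by simpa using h)]
    push Not at h
    refine tendsto_const_nhds.congr' ?_
    have h1 : ∀ᶠ j : ℕ in atTop, 1 / ((j : ℝ) + 1) < (t - a) / 2 :=
      tendsto_one_div_add_atTop_nhds_zero_nat.eventually_lt_const (by linarith)
    filter_upwards [h1] with j hj
    have : (0 : ℝ) < 1 / ((j : ℝ) + 1) := by positivity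
    rw [Real.smoothTransition.one_of_one_le, sub_self]
    rw [le_div_iff₀ this]
    linarith

end SmoothTruncation

/-! ### Chain rule and truncation in `H¹_g(B₁, w)`. -/

section Truncation

theorem tendsto_eLpNorm_two_of_dominated {α F K : Type*} [MeasurableSpace α] {μ : Measure α}
    [NormedAddCommGroup F] [NormedAddCommGroup K] {f : ℕ → α → F} {B : α → K} (hB : MemLp B 2 μ)
    (hf : ∀ k, AEStronglyMeasurable (f k) μ) (hfB : ∀ k, ∀ᵐ x ∂μ, ‖f k x‖ ≤ ‖B x‖)
    (h : ∀ᵐ x ∂μ, Tendsto (fun k => f k x) atTop (𝓝 0)) :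
    Tendsto (fun k => eLpNorm (f k) 2 μ) atTop (𝓝 0) := by
  have h2 : Tendsto (fun k => ∫⁻ x, ‖f k x‖ₑ ^ (2 : ℝ) ∂μ) atTop (𝓝 (∫⁻ _, 0 ∂μ)) := by
    refine tendsto_lintegral_of_dominated_convergence' (fun x => ‖B x‖ₑ ^ (2 : ℝ))
      (fun k => (hf k).enorm.pow_const _) (fun k => ?_) ?_ ?_
    · filter_upwards [hfB k] with x hx
      exact ENNReal.rpow_le_rpow (enorm_le_iff_norm_le.2 hx) (by norm_num)
    · have := eLpNorm_lt_top_iff_lintegral_rpow_enorm_lt_top (by simp) (by simp) |>.1 hB.2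
      simpa using this.ne
    · filter_upwards [h] with x hx
      have h3 : Tendsto (fun k => ‖f k x‖ₑ) atTop (𝓝 0) := by simpa using hx.enorm
      have h4 := (ENNReal.continuous_rpow_const (y := 2)).tendsto 0 |>.comp h3
      simpa [Function.comp_def] using h4
  have h5 := (ENNReal.continuous_rpow_const (y := 1 / 2)).tendsto _ |>.comp h2
  simp only [lintegral_zero, one_div, inv_pos, Nat.ofNat_pos, ENNReal.zero_rpow_of_pos] at h5
  refine h5.congr fun k => ?_
  rw [eLpNorm_eq_lintegral_rpow_enorm_toReal (by simp) (by simp)]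
  simp

variable {n : ℕ} {w u g φ : EuclideanSpace ℝ (Fin n) → ℝ}
  {G : EuclideanSpace ℝ (Fin n) → EuclideanSpace ℝ (Fin n)}

/-- If `S = id` on the values of `g` near `∂B₁`, then `S ∘ (g + φ) - g` is a test function. -/
theorem IsTestFunction.comp_sub (hφ : IsTestFunction φ)
    (hg : ContDiffOn ℝ ∞ g (closedBall 0 1)) {S : ℝ → ℝ} (hS : ContDiff ℝ ∞ S) {r : ℝ}
    (hr : r < 1) (hSg : ∀ x, x ∉ ball (0 : EuclideanSpace ℝ (Fin n)) r →
      x ∈ ball (0 : EuclideanSpace ℝ (Fin n)) 1 → S (g x) = g x) :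
    IsTestFunction ((ball 0 1).indicator fun x => S (g x + φ x) - g x) := by
  set ψ : EuclideanSpace ℝ (Fin n) → ℝ := (ball 0 1).indicator fun x => S (g x + φ x) - g x
  obtain ⟨r', ⟨hr'0, hr'⟩, hsub⟩ := exists_pos_lt_subset_ball one_pos
    hφ.hasCompactSupport.isClosed hφ.tsupport_subset
  -- Outside the ball of radius `max r r'`, but inside `B₁`, both `φ = 0` and `S ∘ g = g`, so `ψ`
  -- vanishes there.
  have hR : max r r' < 1 := max_lt hr hr'
  have hsupp : Function.support ψ ⊆ closedBall 0 (max r r') := by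
    intro x hx
    by_contra hxR
    apply hx
    by_cases hx1 : x ∈ ball (0 : EuclideanSpace ℝ (Fin n)) 1
    · have hxr : max r r' < dist x 0 := by simpa using hxR
      have h1 : φ x = 0 := image_eq_zero_of_notMem_tsupport fun h =>
        (lt_of_le_of_lt (le_max_right r r') hxr).not_ge (mem_ball.1 (hsub h)).le
      have h2 : S (g x) = g x := hSg x
        (fun h => (lt_of_le_of_lt (le_max_left r r') hxr).not_ge (mem_ball.1 h).le) hx1
      simp only [ψ, Set.indicator_of_mem hx1, h1, add_zero, h2, sub_self]
    · exact Set.indicator_of_notMem hx1 _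
  have htsupp : tsupport ψ ⊆ closedBall 0 (max r r') := closure_minimal hsupp isClosed_closedBall
  refine ⟨contDiff_iff_contDiffAt.2 fun x => ?_,
    HasCompactSupport.of_support_subset_isCompact (isCompact_closedBall _ _) hsupp,
    htsupp.trans (closedBall_subset_ball hR)⟩
  by_cases hx1 : x ∈ ball (0 : EuclideanSpace ℝ (Fin n)) 1
  · have hgx : ContDiffAt ℝ ∞ g x := hg.contDiffAt (closedBall_mem_nhds_of_mem hx1)
    have h1 : ContDiffAt ℝ ∞ (fun x => S (g x + φ x) - g x) x :=
      (hS.contDiffAt.comp x (hgx.add hφ.contDiff.contDiffAt)).sub hgx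
    refine h1.congr_of_eventuallyEq ?_
    filter_upwards [isOpen_ball.mem_nhds hx1] with y hy
    exact Set.indicator_of_mem hy _
  · have h1 : x ∉ tsupport ψ := fun h => hx1 (closedBall_subset_ball hR (htsupp h))
    exact contDiffAt_const.congr_of_eventuallyEq (notMem_tsupport_iff_eventuallyEq.1 h1)

theorem gradient_indicator_comp_sub (hφ : IsTestFunction φ)
    (hg : ContDiffOn ℝ ∞ g (closedBall 0 1)) {S : ℝ → ℝ} (hS : ContDiff ℝ ∞ S)
    {x : EuclideanSpace ℝ (Fin n)} (hx : x ∈ ball (0 : EuclideanSpace ℝ (Fin n)) 1) :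
    ∇ ((ball 0 1).indicator fun x => S (g x + φ x) - g x) x =
      deriv S (g x + φ x) • (∇ g x + ∇ φ x) - ∇ g x := by
  have hgx : DifferentiableAt ℝ g x :=
    (hg.contDiffAt (closedBall_mem_nhds_of_mem hx)).differentiableAt (by simp)
  have hφx := hφ.differentiable x
  have hSx : HasDerivAt S (deriv S (g x + φ x)) (g x + φ x) :=
    ((hS.differentiable (by simp)) _).hasDerivAt
  have h1 : (ball 0 1).indicator (fun x => S (g x + φ x) - g x) =ᶠ[𝓝 x]
      fun x => S (g x + φ x) - g x := by
    filter_upwards [isOpen_ball.mem_nhds hx] with y hy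
    exact Set.indicator_of_mem hy _
  have h2 : HasFDerivAt (fun y => S (g y + φ y) - g y)
      (deriv S (g x + φ x) • (fderiv ℝ g x + fderiv ℝ φ x) - fderiv ℝ g x) x :=
    (hSx.comp_hasFDerivAt x (hgx.hasFDerivAt.add hφx.hasFDerivAt)).sub hgx.hasFDerivAt
  simp only [gradient, h1.fderiv_eq, h2.fderiv, map_sub, map_smul, map_add]

/-- If `φₖ → u - g` in `H¹₀`, then `S ∘ (g + φₖ) - g` are test functions. Their values converge
because `S` is 1-Lipschitz, their gradients because `|S'| ≤ 1` and `S'` is continuous. -/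
theorem MemH10Pair.smooth_comp (hw : IsA2Weight w) (hg : ContDiffOn ℝ ∞ g (closedBall 0 1))
    (h : MemH10Pair w (fun x => u x - g x) (fun x => G x - ∇ g x))
    {S : ℝ → ℝ} (hS : ContDiff ℝ ∞ S) (hS' : ∀ t, ‖deriv S t‖ ≤ 1) {r : ℝ}
    (hr : r < 1) (hSg : ∀ x, x ∉ ball (0 : EuclideanSpace ℝ (Fin n)) r →
      x ∈ ball (0 : EuclideanSpace ℝ (Fin n)) 1 → S (g x) = g x) :
    MemH10Pair w (fun x => S (u x) - g x) (fun x => deriv S (u x) • G x - ∇ g x) := by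
  have hfin := hw.isFiniteMeasure
  have hgL := memLp_of_contDiffOn hw hg
  have hgL' := memLp_gradient_of_contDiffOn hw hg
  have huL := h.memLp_of_sub hw hg
  have hGL := h.memLp_grad_of_sub hw hg
  have hSc : Continuous (deriv S) := hS.continuous_deriv (by simp)
  have hLip : ∀ s t, ‖S s - S t‖ ≤ ‖s - t‖ := fun s t => by
    simpa using Convex.norm_image_sub_le_of_norm_deriv_le (s := Set.univ)
      (fun x _ => hS.differentiable (by simp) x) (fun x _ => hS' x) convex_univ
      (Set.mem_univ t) (Set.mem_univ s)
  obtain ⟨φ, hφ, h1, h2⟩ := h.exists_seq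
  -- A.e. convergence of a subsequence is needed to pass to the limit in `S'(g + φₖ)`, by dominated
  -- convergence against `2|G|`.
  have hmeas : TendstoInMeasure (weightMeasureBall w) φ atTop (fun x => u x - g x) :=
    tendstoInMeasure_of_tendsto_eLpNorm (by simp) (fun k => ((hφ k).memLp hw).1) h.memLp.1 h1
  obtain ⟨ns, hns, hae⟩ := hmeas.exists_seq_tendsto_ae
  replace h1 := h1.comp hns.tendsto_atTop
  replace h2 := h2.comp hns.tendsto_atTop
  have hSu : AEStronglyMeasurable (fun x => deriv S (u x)) (weightMeasureBall w) :=
    hSc.comp_aestronglyMeasurable huL.1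
  have hSk : ∀ k, AEStronglyMeasurable (fun x => deriv S (g x + φ (ns k) x))
      (weightMeasureBall w) := fun k =>
    hSc.comp_aestronglyMeasurable (hgL.1.add ((hφ (ns k)).memLp hw).1)
  have hmem : MemLp (fun x => S (u x) - g x) 2 (weightMeasureBall w) := by
    refine MemLp.sub ?_ hgL
    have h3 : MemLp (fun x => S (u x) - S 0) 2 (weightMeasureBall w) :=
      huL.mono ((hS.continuous.comp_aestronglyMeasurable huL.1).sub aestronglyMeasurable_const)
        (ae_of_all _ fun x => by simpa using hLip (u x) 0)
    exact (h3.add (memLp_const (S 0))).ae_eq (ae_of_all _ fun x => by simp)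
  have hmem' : MemLp (fun x => deriv S (u x) • G x - ∇ g x) 2 (weightMeasureBall w) := by
    refine MemLp.sub (hGL.mono (hSu.smul hGL.1) (ae_of_all _ fun x => ?_)) hgL'
    rw [norm_smul]
    exact mul_le_of_le_one_left (norm_nonneg _) (hS' _)
  have hdct : Tendsto (fun k => eLpNorm
      (fun x => (deriv S (u x) - deriv S (g x + φ (ns k) x)) • G x) 2 (weightMeasureBall w))
      atTop (𝓝 0) := by
    refine tendsto_eLpNorm_two_of_dominated (hGL.const_smul (2 : ℝ))
      (fun k => (hSu.sub (hSk k)).smul hGL.1) (fun k => ae_of_all _ fun x => ?_) ?_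
    · rw [norm_smul, Pi.smul_apply, norm_smul]
      gcongr
      refine (norm_sub_le _ _).trans ?_
      rw [Real.norm_ofNat]
      linarith [hS' (u x), hS' (g x + φ (ns k) x)]
    · filter_upwards [hae] with x hx
      have h3 : Tendsto (fun k => g x + φ (ns k) x) atTop (𝓝 (u x)) := by
        simpa using hx.const_add (g x)
      have h4 := ((hSc.tendsto (u x)).comp h3).const_sub (deriv S (u x))
      simpa using h4.smul_const (G x)
  refine MemH10Pair.of_approx hw hmem hmem' fun δ hδ => ?_
  have hsum := (h1.add h2).add hdct
  simp only [add_zero] at hsum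
  obtain ⟨k, hk⟩ := (hsum.eventually_lt_const hδ).exists
  have htest := (hφ (ns k)).comp_sub hg hS hr hSg
  refine ⟨_, _, htest.memH10Pair hw, lt_of_le_of_lt ?_ hk⟩
  rw [add_assoc]
  refine add_le_add ?_ ?_
  · refine eLpNorm_mono_ae ?_
    rw [hw.ae_eq]
    refine (ae_restrict_mem measurableSet_ball).mono fun x hx => ?_
    rw [Set.indicator_of_mem hx, norm_sub_rev (φ (ns k) x)]
    convert! hLip (u x) (g x + φ (ns k) x) using 2 <;> ring
  -- The gradient error splits as `S'(g + φₖ)(G - ∇g - ∇φₖ) + (S'(u) - S'(g + φₖ)) G`: the first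
  -- term is controlled by `|S'| ≤ 1`, the second is `hdct`.
  · have hle := eLpNorm_add_le (p := 2) (μ := weightMeasureBall w)
      (f := fun x => deriv S (g x + φ (ns k) x) • ((G x - ∇ g x) - ∇ (φ (ns k)) x))
      (g := fun x => (deriv S (u x) - deriv S (g x + φ (ns k) x)) • G x)
      ((hSk k).smul ((hGL.sub hgL').sub ((hφ (ns k)).memLp_gradient hw)).1)
      ((hSu.sub (hSk k)).smul hGL.1) (by norm_num)
    refine le_trans (le_of_eq ?_) (hle.trans (add_le_add_left ?_ _))
    · refine eLpNorm_congr_ae ?_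
      rw [EventuallyEq, hw.ae_eq]
      refine (ae_restrict_mem measurableSet_ball).mono fun x hx => ?_
      rw [gradient_indicator_comp_sub (hφ (ns k)) hg hS hx, Pi.add_apply]
      module
    · refine eLpNorm_mono fun x => ?_
      rw [norm_smul, norm_sub_rev]
      exact mul_le_of_le_one_left (norm_nonneg _) (hS' _)

/-- Limit of the smooth truncations `smoothMin a (1 / (j + 1))`: the values converge uniformly, and
the gradients by dominated convergence against `2|G|`. -/
theorem MemH10Pair.min_const (hw : IsA2Weight w) (hg : ContDiffOn ℝ ∞ g (closedBall 0 1))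
    (h : MemH10Pair w (fun x => u x - g x) (fun x => G x - ∇ g x)) {a : ℝ}
    (ha : ∀ x ∈ sphere (0 : EuclideanSpace ℝ (Fin n)) 1, g x ≤ a) :
    MemH10Pair w (fun x => min (u x) a - g x)
      (fun x => (Set.Iic a).indicator (fun _ => (1 : ℝ)) (u x) • G x - ∇ g x) := by
  have hfin := hw.isFiniteMeasure
  have hgL := memLp_of_contDiffOn hw hg
  have hgL' := memLp_gradient_of_contDiffOn hw hg
  have huL := h.memLp_of_sub hw hg
  have hGL := h.memLp_grad_of_sub hw hg
  set χ : ℝ → ℝ := (Set.Iic a).indicator fun _ => (1 : ℝ)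
  have hχ : Measurable χ := measurable_const.indicator measurableSet_Iic
  have hχ1 : ∀ t, ‖χ t‖ ≤ 1 := fun t => by
    by_cases ht : t ∈ Set.Iic a <;> simp [χ, ht]
  have hχu : AEStronglyMeasurable (fun x => χ (u x)) (weightMeasureBall w) :=
    (hχ.comp_aemeasurable huL.1.aemeasurable).aestronglyMeasurable
  have hpos : ∀ j : ℕ, (0 : ℝ) < 1 / ((j : ℝ) + 1) := fun j => by positivity
  have hderiv : ∀ j : ℕ, ∀ t, deriv (smoothMin a (1 / ((j : ℝ) + 1))) t =
      1 - Real.smoothTransition ((t - (a + 1 / ((j : ℝ) + 1))) / (1 / ((j : ℝ) + 1))) :=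
    fun j t => (hasDerivAt_smoothMin (hpos j) t).deriv
  have hderiv1 : ∀ j : ℕ, ∀ t, ‖deriv (smoothMin a (1 / ((j : ℝ) + 1))) t‖ ≤ 1 := fun j t => by
    rw [hderiv, Real.norm_eq_abs, abs_le]
    constructor <;> linarith [Real.smoothTransition.nonneg
      ((t - (a + 1 / ((j : ℝ) + 1))) / (1 / ((j : ℝ) + 1))), Real.smoothTransition.le_one
      ((t - (a + 1 / ((j : ℝ) + 1))) / (1 / ((j : ℝ) + 1)))]
  have hpair : ∀ j : ℕ, MemH10Pair w (fun x => smoothMin a (1 / ((j : ℝ) + 1)) (u x) - g x)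
      (fun x => deriv (smoothMin a (1 / ((j : ℝ) + 1))) (u x) • G x - ∇ g x) := by
    intro j
    -- On the sphere `g ≤ a < a + 1 / (j + 1)`, so the compact set `{g ≥ a + 1 / (j + 1)}` stays
    -- inside a smaller ball. This is why `smoothMin` is the identity slightly beyond `a`: composing
    -- with it leaves `g` unchanged near the boundary.
    have hclosed : IsClosed (closedBall (0 : EuclideanSpace ℝ (Fin n)) 1 ∩
        g ⁻¹' (Set.Ici (a + 1 / ((j : ℝ) + 1)))) :=
      hg.continuousOn.preimage_isClosed_of_isClosed isClosed_closedBall isClosed_Ici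
    obtain ⟨r, ⟨-, hr⟩, hsub⟩ := exists_pos_lt_subset_ball (x := (0 : EuclideanSpace ℝ (Fin n)))
      one_pos hclosed (by
        rintro x ⟨hx, hgx⟩
        refine mem_ball.2 (lt_of_le_of_ne (mem_closedBall.1 hx) fun hx1 => ?_)
        have h1 := ha x (mem_sphere.2 hx1)
        have h2 : a + 1 / ((j : ℝ) + 1) ≤ g x := hgx
        linarith [hpos j])
    refine h.smooth_comp hw hg (contDiff_smoothMin _ _) (hderiv1 j) hr fun x hx hx1 => ?_
    refine smoothMin_of_le (hpos j) (le_of_not_ge fun hle => hx (hsub ⟨?_, hle⟩))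
    exact ball_subset_closedBall hx1
  have h1 : Tendsto (fun j : ℕ => eLpNorm (fun x => min (u x) a -
      smoothMin a (1 / ((j : ℝ) + 1)) (u x)) 2 (weightMeasureBall w)) atTop (𝓝 0) := by
    have hδ : ∀ j : ℕ, 1 / ((j : ℝ) + 1) ≤ 1 := fun j => by
      rw [div_le_one (by positivity)]; linarith [(Nat.cast_nonneg j : (0 : ℝ) ≤ j)]
    refine tendsto_eLpNorm_two_of_dominated (memLp_const (2 : ℝ))
      (fun j => (huL.1.inf aestronglyMeasurable_const).sub
        ((contDiff_smoothMin _ _).continuous.comp_aestronglyMeasurable huL.1))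
      (fun j => ae_of_all _ fun x => ?_) (ae_of_all _ fun x => ?_)
    · rw [norm_sub_rev, Real.norm_eq_abs, Real.norm_ofNat]
      exact (abs_smoothMin_sub_min_le (hpos j) _).trans (by linarith [hδ j])
    · have h0 : Tendsto (fun j : ℕ => 2 * (1 / ((j : ℝ) + 1))) atTop (𝓝 0) := by
        simpa using (tendsto_one_div_add_atTop_nhds_zero_nat (𝕜 := ℝ)).const_mul 2
      refine squeeze_zero_norm (fun j => ?_) h0
      rw [norm_sub_rev]
      exact abs_smoothMin_sub_min_le (hpos j) _
  have h2 : Tendsto (fun j : ℕ => eLpNorm (fun x => (χ (u x) -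
      deriv (smoothMin a (1 / ((j : ℝ) + 1))) (u x)) • G x) 2 (weightMeasureBall w))
      atTop (𝓝 0) := by
    refine tendsto_eLpNorm_two_of_dominated (hGL.const_smul (2 : ℝ))
      (fun j => (hχu.sub (((contDiff_smoothMin _ _).continuous_deriv
        (by simp)).comp_aestronglyMeasurable huL.1)).smul hGL.1)
      (fun j => ae_of_all _ fun x => ?_) (ae_of_all _ fun x => ?_)
    · rw [norm_smul, Pi.smul_apply, norm_smul]
      gcongr
      refine (norm_sub_le _ _).trans ?_
      rw [Real.norm_ofNat]
      linarith [hχ1 (u x), hderiv1 j (u x)]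
    · simp only [hderiv]
      have h3 := ((tendsto_deriv_smoothMin a (u x)).const_sub (χ (u x))).smul_const (G x)
      rwa [sub_self, zero_smul] at h3
  refine MemH10Pair.of_approx hw ?_ ?_ fun δ hδ => ?_
  · exact (huL.inf (memLp_const a)).sub hgL
  · refine MemLp.sub (hGL.mono (hχu.smul hGL.1) (ae_of_all _ fun x => ?_)) hgL'
    rw [norm_smul]
    exact mul_le_of_le_one_left (norm_nonneg _) (hχ1 _)
  · have hsum := h1.add h2
    rw [add_zero] at hsum
    obtain ⟨j, hj⟩ := (hsum.eventually_lt_const hδ).exists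
    refine ⟨_, _, hpair j, lt_of_eq_of_lt ?_ hj⟩
    congr 2
    · ext x; ring
    · ext1 x; module

/-- The positive part of an element of `H¹_g` is in `H¹_g` if `g ≥ 0` on `∂B₁`. -/
theorem MemH10Pair.posPart (hw : IsA2Weight w) (hg : ContDiffOn ℝ ∞ g (closedBall 0 1))
    (h : MemH10Pair w (fun x => u x - g x) (fun x => G x - ∇ g x))
    (hg0 : ∀ x ∈ sphere (0 : EuclideanSpace ℝ (Fin n)) 1, 0 ≤ g x) :
    MemH10Pair w (fun x => max (u x) 0 - g x)
      (fun x => (Set.Ici (0 : ℝ)).indicator (fun _ => (1 : ℝ)) (u x) • G x - ∇ g x) := by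
  have hgrad : ∀ x, ∇ (fun y => -g y) x = -∇ g x := fun x => by
    simp only [gradient, fderiv_fun_neg, map_neg]
  -- Reduction to `min_const` through `max u 0 = -min (-u) 0`, with boundary datum `-g ≤ 0`.
  have h1 : MemH10Pair w (fun x => -u x - -g x) (fun x => -G x - ∇ (fun y => -g y) x) := by
    refine (h.const_mul (-1)).congr (ae_of_all _ fun x => ?_) (ae_of_all _ fun x => ?_)
    · simp only; ring
    · simp only [hgrad]; module
  refine ((h1.min_const hw hg.neg (a := 0) fun x hx => neg_nonpos.2 (hg0 x hx)).const_mul (-1)).congr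
    (ae_of_all _ fun x => ?_) (ae_of_all _ fun x => ?_)
  · have : max (u x) 0 = -min (-u x) 0 := by rw [← max_neg_neg]; simp
    simp only [this]; ring
  · have : (Set.Iic (0 : ℝ)).indicator (fun _ => (1 : ℝ)) (-u x) =
        (Set.Ici (0 : ℝ)).indicator (fun _ => (1 : ℝ)) (u x) := by
      by_cases hx : 0 ≤ u x
      · rw [Set.indicator_of_mem (Set.mem_Ici.2 hx), Set.indicator_of_mem (by simpa using hx)]
      · rw [Set.indicator_of_notMem (by simpa using hx), Set.indicator_of_notMem (by simpa using hx)]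
    simp only [hgrad, this]; module

end Truncation

/-! ### Poincaré inequality and vanishing of `H¹₀` functions with zero gradient. -/

section Poincare

variable {n : ℕ} {w u : EuclideanSpace ℝ (Fin n) → ℝ}
  {G : EuclideanSpace ℝ (Fin n) → EuclideanSpace ℝ (Fin n)}

theorem IsTestFunction.eLpNorm_restrict {φ : EuclideanSpace ℝ (Fin n) → ℝ} (hφ : IsTestFunction φ)
    (p : ℝ≥0∞) : eLpNorm φ p (volume.restrict (ball 0 1)) = eLpNorm φ p volume :=
  eLpNorm_restrict_eq_of_support_subset ((subset_tsupport φ).trans hφ.tsupport_subset)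

theorem IsTestFunction.eLpNorm_gradient_restrict {φ : EuclideanSpace ℝ (Fin n) → ℝ}
    (hφ : IsTestFunction φ) (p : ℝ≥0∞) :
    eLpNorm (∇ φ) p (volume.restrict (ball 0 1)) = eLpNorm (fderiv ℝ φ) p volume := by
  rw [← eLpNorm_congr_norm_ae (f := ∇ φ) (g := fderiv ℝ φ) (ae_of_all _ (norm_gradient φ))]
  refine eLpNorm_restrict_eq_of_support_subset fun x hx => ?_
  by_contra hxB
  exact hx (norm_eq_zero.1 (by rw [norm_gradient, hφ.fderiv_eq_zero hxB, norm_zero]))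

/-- Poincaré inequality in `W^{1,1}_0(B₁)`. -/
theorem exists_eLpNorm_le_eLpNorm_gradient (hn : 2 ≤ n) : ∃ C : ℝ≥0∞, C ≠ ⊤ ∧
    ∀ φ : EuclideanSpace ℝ (Fin n) → ℝ, IsTestFunction φ →
      eLpNorm φ 1 (volume.restrict (ball 0 1)) ≤
        C * eLpNorm (∇ φ) 1 (volume.restrict (ball 0 1)) := by
  refine ⟨eLpNormLESNormFDerivOfLeConst ℝ (volume : Measure (EuclideanSpace ℝ (Fin n)))
    (ball 0 1) 1 1, ENNReal.coe_ne_top, fun φ hφ => ?_⟩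
  rw [hφ.eLpNorm_restrict, hφ.eLpNorm_gradient_restrict]
  -- Gagliardo–Nirenberg–Sobolev on a bounded set with exponent `p = 1`; the requirement `p < n` is
  -- where `2 ≤ n` enters.
  have h := eLpNorm_le_eLpNorm_fderiv (μ := (volume : Measure (EuclideanSpace ℝ (Fin n)))) (p := 1)
    (hφ.contDiff.of_le (by simp)) ((subset_tsupport φ).trans hφ.tsupport_subset) le_rfl
    (by simp only [finrank_euclideanSpace_fin, Nat.one_lt_cast]
        omega) isBounded_ball
  simpa using h

/-- For test functions `φₖ → u` with `∇φₖ → 0` in `L²(w)`, the `L¹` Poincaré inequality forces `φₖ →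
0` in `L¹(B₁)`, while also `φₖ → u` there. -/
theorem MemH10Pair.ae_eq_zero (hw : IsA2Weight w) (hn : 2 ≤ n) (h : MemH10Pair w u (fun _ => 0)) :
    u =ᵐ[weightMeasureBall w] 0 := by
  obtain ⟨C, hC, hP⟩ := exists_eLpNorm_le_eLpNorm_gradient hn
  obtain ⟨φ, hφ, h1, h2⟩ := h.exists_seq
  simp only [sub_zero] at h2
  set W := eLpNorm (fun x => (w x)⁻¹) 2 (weightMeasureBall w)
  have hW : W ≠ ⊤ := hw.memLp_inv.2.ne
  have hbd : ∀ k, eLpNorm u 1 (volume.restrict (ball 0 1)) ≤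
      W * eLpNorm (fun x => φ k x - u x) 2 (weightMeasureBall w) +
        C * (W * eLpNorm (fun x => ∇ (φ k) x) 2 (weightMeasureBall w)) := by
    intro k
    have m1 := (hφ k).memLp hw
    calc eLpNorm u 1 (volume.restrict (ball 0 1))
        = eLpNorm (φ k - (fun x => φ k x - u x)) 1 (volume.restrict (ball 0 1)) := by
          congr 1; ext x; simp
      _ ≤ eLpNorm (φ k) 1 (volume.restrict (ball 0 1)) +
          eLpNorm (fun x => φ k x - u x) 1 (volume.restrict (ball 0 1)) :=
          eLpNorm_sub_le (hw.aestronglyMeasurable_iff.1 m1.1)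
            (hw.aestronglyMeasurable_iff.1 (m1.sub h.memLp).1) le_rfl
      _ ≤ C * (W * eLpNorm (fun x => ∇ (φ k) x) 2 (weightMeasureBall w)) +
          W * eLpNorm (fun x => φ k x - u x) 2 (weightMeasureBall w) := by
          refine add_le_add ((hP _ (hφ k)).trans ?_) (hw.eLpNorm_one_le (m1.sub h.memLp).1)
          gcongr
          exact hw.eLpNorm_one_le ((hφ k).memLp_gradient hw).1
      _ = _ := add_comm _ _
  have hlim : Tendsto (fun k => W * eLpNorm (fun x => φ k x - u x) 2 (weightMeasureBall w) +
        C * (W * eLpNorm (fun x => ∇ (φ k) x) 2 (weightMeasureBall w))) atTop (𝓝 0) := by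
    have t1 := ENNReal.Tendsto.const_mul h1 (Or.inr hW)
    have t2 := ENNReal.Tendsto.const_mul (ENNReal.Tendsto.const_mul h2 (Or.inr hW)) (Or.inr hC)
    simpa using t1.add t2
  have h0 : eLpNorm u 1 (volume.restrict (ball 0 1)) = 0 :=
    le_antisymm (ge_of_tendsto' hlim hbd) zero_le
  rw [EventuallyEq, hw.ae_eq]
  exact (eLpNorm_eq_zero_iff (hw.aestronglyMeasurable_iff.1 h.memLp.1) one_ne_zero).1 h0

end Poincare

/-! ### Compactness in `L¹(B₁)`, by comparison with averages over small balls. -/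

section Rellich

variable {n : ℕ} {w φ : EuclideanSpace ℝ (Fin n) → ℝ}

/-- The fundamental theorem of calculus on the segment from `x` to `x + z`, then Tonelli and
translation invariance. -/
theorem IsTestFunction.lintegral_translate_sub_le (hφ : IsTestFunction φ)
    (z : EuclideanSpace ℝ (Fin n)) :
    ∫⁻ x, ‖φ (x + z) - φ x‖ₑ ≤ ‖z‖ₑ * eLpNorm (fderiv ℝ φ) 1 volume := by
  have hpt : ∀ x, ‖φ (x + z) - φ x‖ₑ ≤
      ∫⁻ t in Set.Ioc (0 : ℝ) 1, ‖fderiv ℝ φ (x + t • z)‖ₑ * ‖z‖ₑ := by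
    intro x
    have hd : ∀ t ∈ Set.uIcc (0 : ℝ) 1,
        HasDerivAt (fun t : ℝ => φ (x + t • z)) (fderiv ℝ φ (x + t • z) z) t := fun t _ => by
      have h1 : HasDerivAt (fun t : ℝ => x + t • z) z t := by
        simpa using ((hasDerivAt_id t).smul_const z).const_add x
      exact (hφ.differentiable _).hasFDerivAt.comp_hasDerivAt t h1
    have hc : Continuous (fun t : ℝ => fderiv ℝ φ (x + t • z) z) :=
      (hφ.continuous_fderiv.comp (by fun_prop)).clm_apply continuous_const
    have h2 := intervalIntegral.integral_eq_sub_of_hasDerivAt hd (hc.intervalIntegrable 0 1)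
    simp only [one_smul, zero_smul, add_zero] at h2
    rw [← h2, intervalIntegral.integral_of_le zero_le_one]
    refine (enorm_integral_le_lintegral_enorm _).trans (lintegral_mono fun t => ?_)
    exact ContinuousLinearMap.le_opENorm _ _
  have hm : Measurable (Function.uncurry fun (x : EuclideanSpace ℝ (Fin n)) (t : ℝ) =>
      ‖fderiv ℝ φ (x + t • z)‖ₑ * ‖z‖ₑ) := by
    have : Continuous (fun p : EuclideanSpace ℝ (Fin n) × ℝ => fderiv ℝ φ (p.1 + p.2 • z)) :=
      hφ.continuous_fderiv.comp (by fun_prop)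
    exact this.enorm.measurable.mul_const _
  calc ∫⁻ x, ‖φ (x + z) - φ x‖ₑ
      ≤ ∫⁻ x, ∫⁻ t in Set.Ioc (0 : ℝ) 1, ‖fderiv ℝ φ (x + t • z)‖ₑ * ‖z‖ₑ := lintegral_mono hpt
    _ = ∫⁻ t in Set.Ioc (0 : ℝ) 1, ∫⁻ x, ‖fderiv ℝ φ (x + t • z)‖ₑ * ‖z‖ₑ :=
        lintegral_lintegral_swap hm.aemeasurable
    _ = ∫⁻ _ in Set.Ioc (0 : ℝ) 1, ‖z‖ₑ * eLpNorm (fderiv ℝ φ) 1 volume := by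
        refine lintegral_congr fun t => ?_
        rw [lintegral_mul_const' _ _ enorm_ne_top, mul_comm,
          lintegral_add_right_eq_self (fun x => ‖fderiv ℝ φ x‖ₑ) (t • z),
          eLpNorm_one_eq_lintegral_enorm]
    _ = ‖z‖ₑ * eLpNorm (fderiv ℝ φ) 1 volume := by simp

/-- Integrate over `z ∈ B_δ` the identity `φ(x) = φ(x + z) - (φ(x + z) - φ(x))`. The differences
cost `δ ‖∇φ‖₁`, uniformly over a sequence with bounded gradients; the averages are what weak
convergence controls. -/
theorem IsTestFunction.mul_eLpNorm_one_le (hφ : IsTestFunction φ) (δ : ℝ) :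
    volume (ball (0 : EuclideanSpace ℝ (Fin n)) δ) * eLpNorm φ 1 volume ≤
      volume (ball (0 : EuclideanSpace ℝ (Fin n)) δ) *
        (ENNReal.ofReal δ * eLpNorm (fderiv ℝ φ) 1 volume) +
      ∫⁻ x in ball 0 1, ‖∫ z in ball 0 δ, φ (x + z)‖ₑ := by
  have hcont := hφ.contDiff.continuous
  have hint : ∀ x, IntegrableOn (fun z => φ (x + z)) (ball 0 δ) volume := fun x =>
    ((hcont.comp (by fun_prop : Continuous fun z => x + z)).continuousOn.integrableOn_compact
      (isCompact_closedBall 0 δ)).mono_set ball_subset_closedBall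
  have hpt : ∀ x, volume (ball (0 : EuclideanSpace ℝ (Fin n)) δ) * ‖φ x‖ₑ ≤
      (∫⁻ z in ball 0 δ, ‖φ (x + z) - φ x‖ₑ) + ‖∫ z in ball 0 δ, φ (x + z)‖ₑ := by
    intro x
    have h1 : ∫ _ in ball (0 : EuclideanSpace ℝ (Fin n)) δ, φ x =
        (∫ z in ball 0 δ, φ (x + z)) - ∫ z in ball 0 δ, (φ (x + z) - φ x) := by
      have h2 : IntegrableOn (fun z => φ (x + z) - φ x) (ball 0 δ) volume :=
        (hint x).sub (integrableOn_const measure_ball_lt_top.ne)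
      rw [← integral_sub (hint x) h2]
      simp
    have h2 : volume (ball (0 : EuclideanSpace ℝ (Fin n)) δ) * ‖φ x‖ₑ =
        ‖∫ _ in ball (0 : EuclideanSpace ℝ (Fin n)) δ, φ x‖ₑ := by
      rw [setIntegral_const, enorm_smul, measureReal_def, Real.enorm_of_nonneg ENNReal.toReal_nonneg,
        ENNReal.ofReal_toReal measure_ball_lt_top.ne]
    rw [h2, h1, add_comm]
    refine (enorm_sub_le).trans (add_le_add le_rfl ?_)
    exact enorm_integral_le_lintegral_enorm _
  have hm : Measurable (Function.uncurry fun (x z : EuclideanSpace ℝ (Fin n)) =>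
      ‖φ (x + z) - φ x‖ₑ) := by
    have : Continuous (fun p : EuclideanSpace ℝ (Fin n) × EuclideanSpace ℝ (Fin n) =>
        φ (p.1 + p.2) - φ p.1) := by fun_prop
    exact this.enorm.measurable
  rw [← hφ.eLpNorm_restrict 1, eLpNorm_one_eq_lintegral_enorm, ← lintegral_const_mul' _ _
    measure_ball_lt_top.ne]
  refine (lintegral_mono hpt).trans ?_
  have hm' : Measurable fun x => ∫⁻ z in ball 0 δ, ‖φ (x + z) - φ x‖ₑ := hm.lintegral_prod_right'
  rw [lintegral_add_left hm']
  refine add_le_add ?_ le_rfl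
  calc ∫⁻ x in ball 0 1, ∫⁻ z in ball 0 δ, ‖φ (x + z) - φ x‖ₑ
      = ∫⁻ z in ball 0 δ, ∫⁻ x in ball 0 1, ‖φ (x + z) - φ x‖ₑ :=
        lintegral_lintegral_swap hm.aemeasurable
    _ ≤ ∫⁻ _ in ball (0 : EuclideanSpace ℝ (Fin n)) δ,
        ENNReal.ofReal δ * eLpNorm (fderiv ℝ φ) 1 volume := by
        refine setLIntegral_mono' measurableSet_ball fun z hz => ?_
        refine (setLIntegral_le_lintegral _ _).trans ((hφ.lintegral_translate_sub_le z).trans ?_)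
        gcongr
        rw [← ofReal_norm]
        exact ENNReal.ofReal_le_ofReal (mem_ball_zero_iff.1 hz).le
    _ = _ := by rw [setLIntegral_const, mul_comm]

/-- Compactness of `W^{1,1}_0(B₁) ⊂ L¹(B₁)`, for sequences that are weakly null in `L¹`. -/
theorem tendsto_eLpNorm_one_of_isTestFunction {ψ : ℕ → EuclideanSpace ℝ (Fin n) → ℝ}
    (hψ : ∀ k, IsTestFunction (ψ k)) {C D : ℝ≥0∞} (hC : C ≠ ⊤) (hD : D ≠ ⊤)
    (hψC : ∀ k, eLpNorm (fderiv ℝ (ψ k)) 1 volume ≤ C) (hψD : ∀ k, eLpNorm (ψ k) 1 volume ≤ D)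
    (h : ∀ s : Set (EuclideanSpace ℝ (Fin n)), MeasurableSet s →
      Tendsto (fun k => ∫ x in s, ψ k x) atTop (𝓝 0)) :
    Tendsto (fun k => eLpNorm (ψ k) 1 volume) atTop (𝓝 0) := by
  -- For fixed `δ` the integral over `B_δ(x)` tends to zero for each `x` by `h`, and it is bounded
  -- by `D`, so dominated convergence applies on `B₁`.
  have havg : ∀ δ : ℝ, Tendsto
      (fun k => ∫⁻ x in ball 0 1, ‖∫ z in ball 0 δ, ψ k (x + z)‖ₑ) atTop (𝓝 0) := by
    intro δ
    have hmp : ∀ x : EuclideanSpace ℝ (Fin n), MeasurePreserving (fun z => x + z) volume volume :=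
      fun x => measurePreserving_add_left volume x
    have heq : ∀ k x, ∫ z in ball 0 δ, ψ k (x + z) = ∫ y in ball x δ, ψ k y := by
      intro k x
      have hpre : (fun z => x + z) ⁻¹' ball x δ = ball 0 δ := by
        ext z
        simp [dist_eq_norm]
      have h1 := (hmp x).setIntegral_preimage_emb (measurableEmbedding_addLeft x) (ψ k) (ball x δ)
      rwa [hpre] at h1
    have hlim := tendsto_lintegral_of_dominated_convergence (μ := volume.restrict (ball 0 1))
      (F := fun k (x : EuclideanSpace ℝ (Fin n)) => ‖∫ z in ball 0 δ, ψ k (x + z)‖ₑ)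
      (f := fun _ => 0) (fun _ => D) (fun k => ?_) (fun k => ae_of_all _ fun x => ?_) ?_
      (ae_of_all _ fun x => ?_)
    · simpa using hlim
    · have hc : Continuous (fun p : EuclideanSpace ℝ (Fin n) × EuclideanSpace ℝ (Fin n) =>
          ψ k (p.1 + p.2)) := (hψ k).contDiff.continuous.comp (by fun_prop)
      exact (hc.stronglyMeasurable.integral_prod_right'
        (ν := volume.restrict (ball 0 δ))).measurable.enorm
    · simp only [heq]
      refine (enorm_integral_le_lintegral_enorm _).trans ((setLIntegral_le_lintegral _ _).trans ?_)
      rw [← eLpNorm_one_eq_lintegral_enorm]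
      exact hψD k
    · rw [setLIntegral_const]
      exact (ENNReal.mul_lt_top hD.lt_top measure_ball_lt_top).ne
    · simp only [heq]
      simpa using (h (ball x δ) measurableSet_ball).enorm
  rw [ENNReal.tendsto_nhds_zero]
  intro η hη
  -- `δ` is fixed before `k`: the translation error is at most `η / 2` for all `k` at once.
  obtain ⟨δ, hδ, hδC⟩ : ∃ δ : ℝ, 0 < δ ∧ ENNReal.ofReal δ * C ≤ η / 2 := by
    have h1 : Tendsto (fun δ : ℝ => ENNReal.ofReal δ * C) (𝓝[>] 0) (𝓝 0) := by
      have h2 : Tendsto (fun δ : ℝ => ENNReal.ofReal δ) (𝓝[>] 0) (𝓝 0) := by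
        simpa using (ENNReal.continuous_ofReal.tendsto 0).mono_left nhdsWithin_le_nhds
      simpa using ENNReal.Tendsto.mul_const h2 (Or.inr hC)
    have h3 := (h1.eventually_lt_const (ENNReal.half_pos hη.ne')).and self_mem_nhdsWithin
    obtain ⟨δ, h4, h5⟩ := h3.exists
    exact ⟨δ, h5, h4.le⟩
  set V := volume (ball (0 : EuclideanSpace ℝ (Fin n)) δ)
  have hV0 : V ≠ 0 := (measure_ball_pos _ _ hδ).ne'
  have hV : V ≠ ⊤ := measure_ball_lt_top.ne
  have hVη : 0 < V * (η / 2) := ENNReal.mul_pos hV0 (ENNReal.half_pos hη.ne').ne'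
  filter_upwards [(havg δ).eventually_le_const hVη] with k hk
  have h1 := (hψ k).mul_eLpNorm_one_le δ
  have h2 : V * eLpNorm (ψ k) 1 volume ≤ V * η := by
    calc V * eLpNorm (ψ k) 1 volume ≤ V * (η / 2) + V * (η / 2) := by
          refine h1.trans (add_le_add ?_ hk)
          gcongr
          refine le_trans ?_ hδC
          gcongr
          exact hψC k
      _ = V * η := by rw [← mul_add, ENNReal.add_halves]
  exact (ENNReal.mul_le_mul_iff_right hV0 hV).1 h2

/-- Compactness of `H¹₀(B₁, w) ⊂ L¹(B₁)`, for weakly null sequences. -/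
theorem tendsto_eLpNorm_one_of_memH10Pair (hw : IsA2Weight w)
    {u : ℕ → EuclideanSpace ℝ (Fin n) → ℝ}
    {G : ℕ → EuclideanSpace ℝ (Fin n) → EuclideanSpace ℝ (Fin n)}
    (h : ∀ k, MemH10Pair w (u k) (G k)) {R : ℝ≥0∞} (hR : R ≠ ⊤)
    (hu : ∀ k, eLpNorm (u k) 2 (weightMeasureBall w) ≤ R)
    (hG : ∀ k, eLpNorm (G k) 2 (weightMeasureBall w) ≤ R)
    (h0 : ∀ s : Set (EuclideanSpace ℝ (Fin n)), MeasurableSet s →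
      Tendsto (fun k => ∫ x in s, u k x ∂(volume.restrict (ball 0 1))) atTop (𝓝 0)) :
    Tendsto (fun k => eLpNorm (u k) 1 (volume.restrict (ball 0 1))) atTop (𝓝 0) := by
  set W := eLpNorm (fun x => (w x)⁻¹) 2 (weightMeasureBall w)
  have hW : W ≠ ⊤ := hw.memLp_inv.2.ne
  have hpos : ∀ k : ℕ, (0 : ℝ≥0∞) < ((k : ℝ≥0∞) + 1)⁻¹ := fun k => by simp
  -- Each `u k` is replaced by a test function within `1 / (k + 1)`; this preserves the bounds up to
  -- `1` and the nullity of integrals over measurable sets.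
  choose ψ hψ hd using fun k : ℕ => (h k).approx _ (hpos k)
  have hlim : Tendsto (fun k : ℕ => ((k : ℝ≥0∞) + 1)⁻¹) atTop (𝓝 0) := by
    have := (tendsto_add_atTop_iff_nat 1).2 ENNReal.tendsto_inv_nat_nhds_zero
    simpa using this
  have hle1 : ∀ k : ℕ, ((k : ℝ≥0∞) + 1)⁻¹ ≤ 1 := fun k => ENNReal.inv_le_one.2 le_add_self
  have m1 : ∀ k, AEStronglyMeasurable (fun x => u k x - ψ k x) (weightMeasureBall w) :=
    fun k => ((h k).memLp.sub ((hψ k).memLp hw)).1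
  have m2 : ∀ k, AEStronglyMeasurable (fun x => G k x - ∇ (ψ k) x) (weightMeasureBall w) :=
    fun k => ((h k).memLp_grad.sub ((hψ k).memLp_gradient hw)).1
  have hdiff : ∀ k, eLpNorm (fun x => u k x - ψ k x) 1 (volume.restrict (ball 0 1)) ≤
      W * ((k : ℝ≥0∞) + 1)⁻¹ := fun k => by
    refine (hw.eLpNorm_one_le (m1 k)).trans ?_
    gcongr
    exact le_self_add.trans (hd k).le
  have hdiff0 : Tendsto (fun k => eLpNorm (fun x => u k x - ψ k x) 1 (volume.restrict (ball 0 1)))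
      atTop (𝓝 0) := by
    have h3 := ENNReal.Tendsto.const_mul hlim (Or.inr hW)
    rw [mul_zero] at h3
    exact tendsto_of_tendsto_of_tendsto_of_le_of_le tendsto_const_nhds h3 (fun _ => zero_le) hdiff
  have hψu : ∀ k, eLpNorm (ψ k) 2 (weightMeasureBall w) ≤ R + 1 := fun k => by
    calc eLpNorm (ψ k) 2 (weightMeasureBall w)
        = eLpNorm (u k - fun x => u k x - ψ k x) 2 (weightMeasureBall w) := by
          congr 1; ext x; simp
      _ ≤ _ := eLpNorm_sub_le (h k).memLp.1 (m1 k) (by norm_num)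
      _ ≤ R + 1 := add_le_add (hu k) ((le_self_add.trans (hd k).le).trans (hle1 k))
  have hψG : ∀ k, eLpNorm (∇ (ψ k)) 2 (weightMeasureBall w) ≤ R + 1 := fun k => by
    calc eLpNorm (∇ (ψ k)) 2 (weightMeasureBall w)
        = eLpNorm (G k - fun x => G k x - ∇ (ψ k) x) 2 (weightMeasureBall w) := by
          congr 1; ext1 x; simp
      _ ≤ _ := eLpNorm_sub_le (h k).memLp_grad.1 (m2 k) (by norm_num)
      _ ≤ R + 1 := add_le_add (hG k) ((le_add_self.trans (hd k).le).trans (hle1 k))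
  have hψ0 : Tendsto (fun k => eLpNorm (ψ k) 1 volume) atTop (𝓝 0) := by
    have hWR : W * (R + 1) ≠ ⊤ := ENNReal.mul_ne_top hW (by simpa using hR)
    refine tendsto_eLpNorm_one_of_isTestFunction hψ hWR hWR (fun k => ?_) (fun k => ?_)
      fun s hs => ?_
    · rw [← (hψ k).eLpNorm_gradient_restrict]
      refine (hw.eLpNorm_one_le ((hψ k).memLp_gradient hw).1).trans ?_
      gcongr
      exact hψG k
    · rw [← (hψ k).eLpNorm_restrict]
      refine (hw.eLpNorm_one_le ((hψ k).memLp hw).1).trans ?_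
      gcongr
      exact hψu k
    · have e1 : ∀ k, ∫ x in s, ψ k x = (∫ x in s, u k x ∂(volume.restrict (ball 0 1))) -
          ∫ x in s, (u k x - ψ k x) ∂(volume.restrict (ball 0 1)) := by
        intro k
        have i1 : Integrable (u k) (volume.restrict (ball 0 1)) := hw.integrableOn (h k).memLp
        have i2 : Integrable (ψ k) (volume.restrict (ball 0 1)) :=
          hw.integrableOn ((hψ k).memLp hw)
        rw [integral_sub i1.integrableOn i2.integrableOn, sub_sub_cancel,
          Measure.restrict_restrict hs]
        refine (setIntegral_eq_of_subset_of_forall_sdiff_eq_zero hs Set.inter_subset_left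
          fun x hx => (hψ k).eq_zero fun hxB => hx.2 ⟨hx.1, hxB⟩).symm ▸ rfl
      simp only [e1]
      have e2 : Tendsto (fun k => ∫ x in s, (u k x - ψ k x) ∂(volume.restrict (ball 0 1))) atTop
          (𝓝 0) := by
        refine tendsto_zero_iff_enorm_tendsto_zero.2 ?_
        refine tendsto_of_tendsto_of_tendsto_of_le_of_le tendsto_const_nhds hdiff0
          (fun _ => zero_le) fun k => ?_
        refine (enorm_integral_le_lintegral_enorm _).trans ((setLIntegral_le_lintegral _ _).trans ?_)
        rw [← eLpNorm_one_eq_lintegral_enorm]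
      simpa using (h0 s hs).sub e2
  have hsum := hψ0.add hdiff0
  rw [add_zero] at hsum
  refine tendsto_of_tendsto_of_tendsto_of_le_of_le tendsto_const_nhds hsum (fun _ => zero_le)
    fun k => ?_
  simp only [← (hψ k).eLpNorm_restrict]
  calc eLpNorm (u k) 1 (volume.restrict (ball 0 1))
      = eLpNorm (ψ k + fun x => u k x - ψ k x) 1 (volume.restrict (ball 0 1)) := by
        congr 1; ext x; simp
    _ ≤ _ := eLpNorm_add_le (hw.aestronglyMeasurable_iff.1 ((hψ k).memLp hw).1)
        (hw.aestronglyMeasurable_iff.1 (m1 k)) le_rfl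

end Rellich

/-! ### Weak sequential compactness in `H¹₀(B₁, w)`. -/

section WeakCompactness

/-- Bounded sequences in a separable Hilbert space have weakly convergent subsequences. -/
theorem exists_subseq_tendsto_inner {X : Type*} [NormedAddCommGroup X] [InnerProductSpace ℝ X]
    [CompleteSpace X] [TopologicalSpace.SeparableSpace X] {x : ℕ → X} {R : ℝ}
    (hx : ∀ k, ‖x k‖ ≤ R) :
    ∃ (a : X) (ns : ℕ → ℕ), StrictMono ns ∧
      ∀ y, Tendsto (fun k => ⟪x (ns k), y⟫) atTop (𝓝 ⟪a, y⟫) := by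
  -- The Riesz isometry turns the claim into the sequential Banach–Alaoglu theorem.
  have hmem : ∀ k, (InnerProductSpace.toDual ℝ X (x k)).toWeakDual ∈
      (WeakDual.toStrongDual ⁻¹' closedBall (0 : StrongDual ℝ X) R) := fun k => by
    simpa using hx k
  obtain ⟨f, -, ns, hns, hlim⟩ := WeakDual.isSeqCompact_closedBall ℝ X 0 R hmem
  refine ⟨(InnerProductSpace.toDual ℝ X).symm (WeakDual.toStrongDual f), ns, hns, fun y => ?_⟩
  rw [InnerProductSpace.toDual_symm_apply]
  exact ((WeakDual.eval_continuous y).tendsto f).comp hlim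

/-- A closed subspace equals its double orthogonal complement, and orthogonality to a fixed vector
survives weak limits. -/
theorem Submodule.mem_of_tendsto_inner {X : Type*} [NormedAddCommGroup X] [InnerProductSpace ℝ X]
    [CompleteSpace X] {K : Submodule ℝ X} (hK : IsClosed (K : Set X)) {x : ℕ → X} {a : X}
    (hx : ∀ k, x k ∈ K) (h : ∀ y, Tendsto (fun k => ⟪x k, y⟫) atTop (𝓝 ⟪a, y⟫)) : a ∈ K := by
  have hc : IsComplete (K : Set X) := hK.isComplete
  have : CompleteSpace K := hc.completeSpace_coe
  rw [← K.orthogonal_orthogonal, Submodule.mem_orthogonal']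
  intro y hy
  refine tendsto_nhds_unique (h y) (tendsto_const_nhds.congr fun k => ?_)
  exact ((Submodule.mem_orthogonal _ _).1 hy _ (hx k)).symm

variable {n : ℕ} {w u v : EuclideanSpace ℝ (Fin n) → ℝ}
  {G H : EuclideanSpace ℝ (Fin n) → EuclideanSpace ℝ (Fin n)}
  {μ : Measure (EuclideanSpace ℝ (Fin n))}

/-- The `ℓ²` product makes `L²` of pairs a Hilbert space, so one extraction yields the weak limits
of the functions and of the gradients. -/
theorem MeasureTheory.MemLp.toLp_prodMk (hu : MemLp u 2 μ) (hG : MemLp G 2 μ) :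
    MemLp (fun x => WithLp.toLp 2 (u x, G x)) 2 μ := by
  refine MemLp.mono (hu.norm.add hG.norm)
    ((WithLp.prod_continuous_toLp 2 _ _).comp_aestronglyMeasurable (hu.1.prodMk hG.1))
    (ae_of_all _ fun x => ?_)
  have h0 : 0 ≤ ‖u x‖ + ‖G x‖ := by positivity
  rw [Pi.add_apply, Real.norm_of_nonneg h0]
  refine (sq_le_sq₀ (norm_nonneg _) h0).1 ?_
  rw [WithLp.prod_norm_sq_eq_of_L2]
  simp only [WithLp.toLp_fst, WithLp.toLp_snd]
  nlinarith [norm_nonneg (u x), norm_nonneg (G x)]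

theorem MeasureTheory.MemLp.withLp_fst {f : EuclideanSpace ℝ (Fin n) →
    WithLp 2 (ℝ × EuclideanSpace ℝ (Fin n))} (hf : MemLp f 2 μ) : MemLp (fun x => (f x).fst) 2 μ :=
  hf.mono ((WithLp.continuous_fst 2 _ _).comp_aestronglyMeasurable hf.1)
    (ae_of_all _ fun _ => WithLp.norm_fst_le _ _)

theorem MeasureTheory.MemLp.withLp_snd {f : EuclideanSpace ℝ (Fin n) →
    WithLp 2 (ℝ × EuclideanSpace ℝ (Fin n))} (hf : MemLp f 2 μ) : MemLp (fun x => (f x).snd) 2 μ :=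
  hf.mono ((WithLp.continuous_snd 2 _ _).comp_aestronglyMeasurable hf.1)
    (ae_of_all _ fun _ => WithLp.norm_snd_le _ _)

/-- The closure of `{(φ, ∇φ) : φ ∈ C_c^∞(B₁)}` as a subspace of `L²(B₁, w)`. -/
noncomputable def h10Submodule (hw : IsA2Weight w) :
    Submodule ℝ (Lp (WithLp 2 (ℝ × EuclideanSpace ℝ (Fin n))) 2 (weightMeasureBall w)) where
  carrier := {f | MemH10Pair w (fun x => (f x).fst) (fun x => (f x).snd)}
  zero_mem' := (memH10Pair_zero hw).congr
    (by filter_upwards [Lp.coeFn_zero (WithLp 2 (ℝ × EuclideanSpace ℝ (Fin n))) 2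
          (weightMeasureBall w)] with x hx; rw [hx]; rfl)
    (by filter_upwards [Lp.coeFn_zero (WithLp 2 (ℝ × EuclideanSpace ℝ (Fin n))) 2
          (weightMeasureBall w)] with x hx; rw [hx]; rfl)
  add_mem' {f f'} hf hf' := (MemH10Pair.add hw hf hf').congr
    (by filter_upwards [Lp.coeFn_add f f'] with x hx; rw [hx]; rfl)
    (by filter_upwards [Lp.coeFn_add f f'] with x hx; rw [hx]; rfl)
  smul_mem' c f hf := (MemH10Pair.const_mul hf c).congr
    (by filter_upwards [Lp.coeFn_smul c f] with x hx; rw [hx]; rfl)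
    (by filter_upwards [Lp.coeFn_smul c f] with x hx; rw [hx]; rfl)

theorem isClosed_h10Submodule (hw : IsA2Weight w) :
    IsClosed (h10Submodule hw : Set
      (Lp (WithLp 2 (ℝ × EuclideanSpace ℝ (Fin n))) 2 (weightMeasureBall w))) := by
  refine isClosed_of_closure_subset fun f hf => ?_
  refine MemH10Pair.of_approx hw (Lp.memLp f).withLp_fst (Lp.memLp f).withLp_snd fun δ hδ => ?_
  obtain ⟨f', hf', hd⟩ := EMetric.mem_closure_iff.1 hf (δ / 2) (ENNReal.half_pos hδ.ne')
  refine ⟨_, _, hf', ?_⟩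
  rw [Lp.edist_def] at hd
  refine (ENNReal.add_lt_add (lt_of_le_of_lt (eLpNorm_mono fun x => ?_) hd)
    (lt_of_le_of_lt (eLpNorm_mono fun x => ?_) hd)).trans_eq (ENNReal.add_halves δ)
  · exact WithLp.norm_fst_le _ (f x - f' x)
  · exact WithLp.norm_snd_le _ (f x - f' x)

/-- Weak compactness of bounded sets of `H¹₀(B₁, w)`. -/
theorem exists_subseq_tendsto_memH10Pair (hw : IsA2Weight w)
    {u : ℕ → EuclideanSpace ℝ (Fin n) → ℝ}
    {G : ℕ → EuclideanSpace ℝ (Fin n) → EuclideanSpace ℝ (Fin n)}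
    (h : ∀ k, MemH10Pair w (u k) (G k)) {R : ℝ≥0∞} (hR : R ≠ ⊤)
    (hu : ∀ k, eLpNorm (u k) 2 (weightMeasureBall w) ≤ R)
    (hG : ∀ k, eLpNorm (G k) 2 (weightMeasureBall w) ≤ R) :
    ∃ (v : EuclideanSpace ℝ (Fin n) → ℝ) (H : EuclideanSpace ℝ (Fin n) → EuclideanSpace ℝ (Fin n))
      (ns : ℕ → ℕ), StrictMono ns ∧ MemH10Pair w v H ∧
      (∀ f, MemLp f 2 (weightMeasureBall w) →
        Tendsto (fun k => ∫ x, u (ns k) x * f x ∂(weightMeasureBall w)) atTop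
          (𝓝 (∫ x, v x * f x ∂(weightMeasureBall w)))) ∧
      ∀ F : EuclideanSpace ℝ (Fin n) → EuclideanSpace ℝ (Fin n), MemLp F 2 (weightMeasureBall w) →
        Tendsto (fun k => ∫ x, ⟪G (ns k) x, F x⟫ ∂(weightMeasureBall w)) atTop
          (𝓝 (∫ x, ⟪H x, F x⟫ ∂(weightMeasureBall w))) := by
  have := hw.isFiniteMeasure
  have : Fact ((2 : ℝ≥0∞) ≠ ⊤) := ⟨by simp⟩
  set μ := weightMeasureBall w
  have hp : ∀ k, MemLp (fun x => WithLp.toLp 2 (u k x, G k x)) 2 μ := fun k =>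
    (h k).memLp.toLp_prodMk (h k).memLp_grad
  set X : ℕ → Lp (WithLp 2 (ℝ × EuclideanSpace ℝ (Fin n))) 2 μ := fun k => (hp k).toLp _
  have hX : ∀ k, ‖X k‖ ≤ (R + R).toReal := by
    intro k
    rw [Lp.norm_toLp]
    refine ENNReal.toReal_mono (by simpa using hR) ?_
    refine (eLpNorm_mono (g := fun x => ‖u k x‖ + ‖G k x‖) fun x => ?_).trans
      ((eLpNorm_add_le (h k).memLp.1.norm (h k).memLp_grad.1.norm (by norm_num)).trans
        (add_le_add ((eLpNorm_norm _).trans_le (hu k)) ((eLpNorm_norm _).trans_le (hG k))))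
    have h0 : 0 ≤ ‖u k x‖ + ‖G k x‖ := by positivity
    rw [Real.norm_of_nonneg h0]
    refine (sq_le_sq₀ (norm_nonneg _) h0).1 ?_
    rw [WithLp.prod_norm_sq_eq_of_L2]
    simp only [WithLp.toLp_fst, WithLp.toLp_snd]
    nlinarith [norm_nonneg (u k x), norm_nonneg (G k x)]
  have hXK : ∀ k, X k ∈ h10Submodule hw := fun k => (h k).congr
    (by filter_upwards [(hp k).coeFn_toLp] with x hx; rw [hx, WithLp.toLp_fst])
    (by filter_upwards [(hp k).coeFn_toLp] with x hx; rw [hx, WithLp.toLp_snd])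
  obtain ⟨a, ns, hns, hlim⟩ := exists_subseq_tendsto_inner hX
  have haK : a ∈ h10Submodule hw :=
    Submodule.mem_of_tendsto_inner (isClosed_h10Submodule hw) (fun k => hXK (ns k)) hlim
  have hinner : ∀ (f : EuclideanSpace ℝ (Fin n) → ℝ)
      (F : EuclideanSpace ℝ (Fin n) → EuclideanSpace ℝ (Fin n)) (hf : MemLp f 2 μ)
      (hF : MemLp F 2 μ), Tendsto (fun k => ∫ x, (u (ns k) x * f x + ⟪G (ns k) x, F x⟫) ∂μ) atTop
        (𝓝 (∫ x, ((a x).fst * f x + ⟪(a x).snd, F x⟫) ∂μ)) := by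
    intro f F hf hF
    have h1 := hlim ((hf.toLp_prodMk hF).toLp _)
    simp only [L2.inner_def] at h1
    refine Tendsto.congr' (Eventually.of_forall fun k => ?_) (h1.trans (le_of_eq (congrArg 𝓝 ?_)))
    · refine integral_congr_ae ?_
      filter_upwards [(hp (ns k)).coeFn_toLp, (hf.toLp_prodMk hF).coeFn_toLp] with x hx hx'
      rw [hx, hx', WithLp.prod_inner_apply]
      simp [mul_comm]
    · refine integral_congr_ae ?_
      filter_upwards [(hf.toLp_prodMk hF).coeFn_toLp] with x hx'
      rw [hx', WithLp.prod_inner_apply]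
      simp only [WithLp.ofLp_fst, WithLp.ofLp_snd, RCLike.inner_apply]
      simp [mul_comm]
  -- The two limits are separated by testing against `(f, 0)` and `(0, F)`.
  refine ⟨fun x => (a x).fst, fun x => (a x).snd, ns, hns, haK, fun f hf => ?_, fun F hF => ?_⟩
  · simpa using hinner f 0 hf MemLp.zero'
  · simpa using hinner 0 F MemLp.zero' hF

end WeakCompactness

/-! ### The penalized energy and the subsolution property. -/

section Energy

variable {n : ℕ} {w u v g φ : EuclideanSpace ℝ (Fin n) → ℝ}
  {G H : EuclideanSpace ℝ (Fin n) → EuclideanSpace ℝ (Fin n)}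
  {μ : Measure (EuclideanSpace ℝ (Fin n))} {ε m : ℝ}

theorem MeasureTheory.MemLp.integrable_inner_of_two (hG : MemLp G 2 μ) (hH : MemLp H 2 μ) :
    Integrable (fun x => ⟪G x, H x⟫) μ :=
  (hG.norm.integrable_mul hH.norm).mono (hG.1.inner hH.1)
    (ae_of_all _ fun _ => (norm_inner_le_norm _ _).trans (le_abs_self _))

theorem MeasureTheory.MemLp.integrable_norm_sq (hG : MemLp G 2 μ) :
    Integrable (fun x => ‖G x‖ ^ 2) μ :=
  (memLp_two_iff_integrable_sq_norm hG.1).1 hG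

theorem penalty_nonneg (hε : 0 < ε) (t : ℝ) : 0 ≤ penalty ε m t :=
  mul_nonneg (by positivity) (le_max_right _ _)

theorem penalty_mono (hε : 0 < ε) : Monotone (penalty ε m) := fun _ _ hst => by
  unfold penalty
  gcongr

theorem continuous_penalty : Continuous (penalty ε m) := by
  unfold penalty
  fun_prop

theorem penalizedEnergy_eq (hw : IsA2Weight w) (hG : weakGrad v =ᵐ[weightMeasureBall w] G) :
    penalizedEnergy ε m w v = (∫ x, ‖G x‖ ^ 2 ∂(weightMeasureBall w)) +
      penalty ε m ((weightMeasureBall w).real {x | 0 < v x}) := by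
  have h1 : ∫ x, ‖G x‖ ^ 2 ∂(weightMeasureBall w) =
      ∫ x in ball 0 1, ‖weakGrad v x‖ ^ 2 * w x := by
    rw [← integral_congr_ae (f := fun x => ‖weakGrad v x‖ ^ 2), hw.integral_eq]
    · simp only [mul_comm]
    · filter_upwards [hG] with x hx
      rw [hx]
  rw [penalizedEnergy, h1, measureReal_def, measureReal_def, weightMeasureBall,
    Measure.restrict_apply' measurableSet_ball]

theorem MemH10Pair.penalizedEnergy_eq (hw : IsA2Weight w) (hg : ContDiffOn ℝ ∞ g (closedBall 0 1))
    (h : MemH10Pair w (fun x => v x - g x) (fun x => G x - ∇ g x)) :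
    penalizedEnergy ε m w v = (∫ x, ‖G x‖ ^ 2 ∂(weightMeasureBall w)) +
      penalty ε m ((weightMeasureBall w).real {x | 0 < v x}) :=
  _root_.penalizedEnergy_eq hw ((h.hasWeakGrad_of_sub hw hg).weakGrad_ae_eq' hw)

/-- First variation along `u - tφ` with `t > 0` only. The penalty does not increase because `{u - tφ
> 0} ⊂ {u > 0}` a.e., so minimality bounds `2 ∫ ⟪∇u, ∇φ⟫ w` by `t ∫ |∇φ|² w`. -/
theorem IsPenalizedMinimizer.isWeakSubsolution (hw : IsA2Weight w)
    (hg : ContDiffOn ℝ ∞ g (closedBall 0 1)) (hε : 0 < ε)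
    (hu : IsPenalizedMinimizer ε m w g u) : IsWeakSubsolution w u := by
  have hfin := hw.isFiniteMeasure
  refine ⟨hu.1.1, fun φ hφ hφ0 => ?_⟩
  rw [← hw.integral_eq fun x => ⟪weakGrad u x, weakGrad φ x⟫]
  have hG := hu.1.1.memLp_grad
  have hΦ := hφ.1.memLp_grad
  have hkey : ∀ t : ℝ, 0 < t → 2 * ∫ x, ⟪weakGrad u x, weakGrad φ x⟫ ∂(weightMeasureBall w) ≤
      t * ∫ x, ‖weakGrad φ x‖ ^ 2 ∂(weightMeasureBall w) := by
    intro t ht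
    have hpair : MemH10Pair w (fun x => (u x - t * φ x) - g x)
        (fun x => (weakGrad u x - t • weakGrad φ x) - ∇ g x) := by
      refine ((hu.1.memH10Pair hw hg).sub hw ((hφ.memH10Pair hw).const_mul t)).congr
        (ae_of_all _ fun x => ?_) (ae_of_all _ fun x => ?_)
      · ring
      · simp only; abel
    have hmin := hu.2 _ (hpair.memH1g hw hg)
    rw [penalizedEnergy_eq hw EventuallyEq.rfl, hpair.penalizedEnergy_eq hw hg] at hmin
    have hpen : penalty ε m ((weightMeasureBall w).real {x | 0 < u x - t * φ x}) ≤
        penalty ε m ((weightMeasureBall w).real {x | 0 < u x}) := by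
      refine penalty_mono hε (ENNReal.toReal_mono (measure_ne_top _ _) (measure_mono_ae ?_))
      rw [← hw.ae_eq] at hφ0
      filter_upwards [hφ0] with x hx h0
      have h1 : 0 < u x - t * φ x := h0
      have h2 : 0 < u x := by nlinarith
      exact h2
    have hexp : ∫ x, ‖weakGrad u x - t • weakGrad φ x‖ ^ 2 ∂(weightMeasureBall w) =
        (∫ x, ‖weakGrad u x‖ ^ 2 ∂(weightMeasureBall w)) -
          2 * t * (∫ x, ⟪weakGrad u x, weakGrad φ x⟫ ∂(weightMeasureBall w)) +
          t ^ 2 * ∫ x, ‖weakGrad φ x‖ ^ 2 ∂(weightMeasureBall w) := by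
      have hi := (hG.integrable_inner_of_two hΦ).const_mul (2 * t)
      rw [← integral_const_mul, ← integral_const_mul, ← integral_sub hG.integrable_norm_sq hi,
        ← integral_add (f := fun x => ‖weakGrad u x‖ ^ 2 - 2 * t * ⟪weakGrad u x, weakGrad φ x⟫)
          (hG.integrable_norm_sq.sub hi) (hΦ.integrable_norm_sq.const_mul _)]
      congr 1
      ext x
      rw [norm_sub_sq_real, inner_smul_right, norm_smul, mul_pow, Real.norm_eq_abs, sq_abs]
      ring
    rw [hexp] at hmin
    have h3 : t * (2 * ∫ x, ⟪weakGrad u x, weakGrad φ x⟫ ∂(weightMeasureBall w)) ≤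
        t * (t * ∫ x, ‖weakGrad φ x‖ ^ 2 ∂(weightMeasureBall w)) := by linarith
    exact le_of_mul_le_mul_left h3 ht
  have hlim : Tendsto (fun t : ℝ => t * ∫ x, ‖weakGrad φ x‖ ^ 2 ∂(weightMeasureBall w)) (𝓝[>] 0)
      (𝓝 0) := by
    have h1 : Tendsto (fun t : ℝ => t) (𝓝[>] 0) (𝓝 0) := tendsto_id.mono_left nhdsWithin_le_nhds
    simpa using h1.mul_const _
  have := ge_of_tendsto hlim (eventually_mem_nhdsWithin.mono fun t ht => hkey t ht)
  linarith

end Energy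

/-! ### Maximum principle and truncation of competitors. -/

section Boundary

variable {n : ℕ} {w u v g : EuclideanSpace ℝ (Fin n) → ℝ}
  {G : EuclideanSpace ℝ (Fin n) → EuclideanSpace ℝ (Fin n)} {ε m : ℝ}

theorem abs_le_boundarySup (hg : ContDiffOn ℝ ∞ g (closedBall 0 1)) {x : EuclideanSpace ℝ (Fin n)}
    (hx : x ∈ sphere (0 : EuclideanSpace ℝ (Fin n)) 1) : |g x| ≤ boundarySup g :=
  le_csSup ((isCompact_sphere _ _).bddAbove_image
    (hg.continuousOn.mono sphere_subset_closedBall).abs) (Set.mem_image_of_mem _ hx)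

theorem boundarySup_pos (hn : 2 ≤ n) (hg : ContDiffOn ℝ ∞ g (closedBall 0 1))
    (hgpos : ∃ c : ℝ, 0 < c ∧ ∀ x ∈ sphere (0 : EuclideanSpace ℝ (Fin n)) 1, c ≤ g x) :
    0 < boundarySup g := by
  obtain ⟨c, hc, hcg⟩ := hgpos
  have : Nonempty (Fin n) := ⟨⟨0, by omega⟩⟩
  obtain ⟨x, hx⟩ := NormedSpace.sphere_nonempty (x := (0 : EuclideanSpace ℝ (Fin n))).2 zero_le_one
  exact hc.trans_le ((hcg x hx).trans ((le_abs_self _).trans (abs_le_boundarySup hg hx)))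

/-- The maximum principle for subsolutions with boundary values `g`. -/
theorem IsWeakSubsolution.le_boundarySup (hw : IsA2Weight w) (hn : 2 ≤ n)
    (hg : ContDiffOn ℝ ∞ g (closedBall 0 1)) (hug : MemH1g w g u) (hu : IsWeakSubsolution w u) :
    ∀ᵐ x ∂(weightMeasureBall w), u x ≤ boundarySup g := by
  set M := boundarySup g
  set χ : ℝ → ℝ := (Set.Iic M).indicator fun _ => (1 : ℝ)
  have h := hug.memH10Pair hw hg
  have hmin := h.min_const hw hg (a := M) fun x hx =>
    (le_abs_self _).trans (abs_le_boundarySup hg hx)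
  -- The test function is `(u - M)⁺`, written as a difference of two elements of `H¹_g`, so the
  -- boundary datum cancels.
  have hpair : MemH10Pair w (fun x => u x - min (u x) M)
      (fun x => weakGrad u x - χ (u x) • weakGrad u x) := by
    refine (h.sub hw hmin).congr (ae_of_all _ fun x => ?_) (ae_of_all _ fun x => ?_)
    · ring
    · simp only [χ]; abel
  have hle := hu.2 _ (hpair.memH10 hw) (ae_of_all _ fun x => sub_nonneg.2 (min_le_left _ _))
  rw [← hw.integral_eq fun x => ⟪weakGrad u x, weakGrad (fun x => u x - min (u x) M) x⟫] at hle
  -- The gradient of `(u - M)⁺` is `∇u` where `u > M` and zero elsewhere, so its inner product with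
  -- `∇u` is its own square.
  have heq : ∫ x, ⟪weakGrad u x, weakGrad (fun x => u x - min (u x) M) x⟫ ∂(weightMeasureBall w) =
      ∫ x, ‖weakGrad u x - χ (u x) • weakGrad u x‖ ^ 2 ∂(weightMeasureBall w) := by
    refine integral_congr_ae ?_
    filter_upwards [(hpair.hasWeakGrad hw).weakGrad_ae_eq' hw] with x hx
    rw [hx]
    by_cases hxM : u x ∈ Set.Iic M
    · simp [χ, Set.indicator_of_mem hxM]
    · simp [χ, Set.indicator_of_notMem hxM]
  rw [heq] at hle
  have h0 : ∫ x, ‖weakGrad u x - χ (u x) • weakGrad u x‖ ^ 2 ∂(weightMeasureBall w) = 0 :=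
    le_antisymm hle (integral_nonneg fun x => by positivity)
  rw [integral_eq_zero_iff_of_nonneg (fun x => by positivity)
    hpair.memLp_grad.integrable_norm_sq] at h0
  have hzero : MemH10Pair w (fun x => u x - min (u x) M) (fun _ => 0) := by
    refine hpair.congr EventuallyEq.rfl ?_
    filter_upwards [h0] with x hx
    simpa using hx
  filter_upwards [hzero.ae_eq_zero hw hn] with x hx
  have h1 : u x - min (u x) M = 0 := hx
  rw [sub_eq_zero] at h1
  exact h1 ▸ min_le_right _ _

/-- Truncation to `[0, ‖g‖_∞]` does not increase the energy. -/
theorem MemH1g.exists_truncation (hw : IsA2Weight w) (hn : 2 ≤ n)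
    (hg : ContDiffOn ℝ ∞ g (closedBall 0 1))
    (hgpos : ∃ c : ℝ, 0 < c ∧ ∀ x ∈ sphere (0 : EuclideanSpace ℝ (Fin n)) 1, c ≤ g x)
    (hε : 0 < ε) (hv : MemH1g w g v) :
    ∃ (u : EuclideanSpace ℝ (Fin n) → ℝ)
      (G : EuclideanSpace ℝ (Fin n) → EuclideanSpace ℝ (Fin n)),
      MemH10Pair w (fun x => u x - g x) (fun x => G x - ∇ g x) ∧
      (∀ x, 0 ≤ u x ∧ u x ≤ boundarySup g) ∧
      (∫ x, ‖G x‖ ^ 2 ∂(weightMeasureBall w)) +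
        penalty ε m ((weightMeasureBall w).real {x | 0 < u x}) ≤ penalizedEnergy ε m w v := by
  have hfin := hw.isFiniteMeasure
  have hM := boundarySup_pos hn hg hgpos
  obtain ⟨c, hc, hcg⟩ := hgpos
  have h := hv.memH10Pair hw hg
  have h1 := (h.posPart hw hg fun x hx => hc.le.trans (hcg x hx)).min_const hw hg
    (a := boundarySup g) fun x hx => (le_abs_self _).trans (abs_le_boundarySup hg hx)
  refine ⟨_, _, h1, fun x => ⟨le_min (le_max_right _ _) hM.le, min_le_right _ _⟩, ?_⟩
  rw [penalizedEnergy_eq hw EventuallyEq.rfl]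
  have hind : ∀ (s : Set ℝ) (t : ℝ) (e : EuclideanSpace ℝ (Fin n)),
      ‖s.indicator (fun _ => (1 : ℝ)) t • e‖ ≤ ‖e‖ := fun s t e => by
    by_cases hts : t ∈ s
    · simp [Set.indicator_of_mem hts]
    · simp [Set.indicator_of_notMem hts]
  refine add_le_add ?_ (penalty_mono hε ?_)
  · refine integral_mono (h1.memLp_grad_of_sub hw hg).integrable_norm_sq
      hv.1.memLp_grad.integrable_norm_sq fun x => ?_
    have := (hind (Set.Iic (boundarySup g)) (max (v x) 0) _).trans
      (hind (Set.Ici 0) (v x) (weakGrad v x))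
    dsimp only
    gcongr
  -- As `‖g‖_∞ > 0`, the clipped function is positive only where `v` is.
  · refine measureReal_mono fun x hx => ?_
    have h2 : 0 < min (max (v x) 0) (boundarySup g) := hx
    simpa [hM] using h2

end Boundary

/-! ### Existence of a minimizer. -/

section Existence

variable {n : ℕ} {w u v g : EuclideanSpace ℝ (Fin n) → ℝ}
  {G : EuclideanSpace ℝ (Fin n) → EuclideanSpace ℝ (Fin n)} {ε m : ℝ}

/-- `1_s w⁻¹` lies in `L²(w)`, so weak convergence in `L²(w)` tested against it gives convergence of
the unweighted integrals over `s`. -/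
theorem IsA2Weight.integral_mul_indicator_inv (hw : IsA2Weight w)
    {s : Set (EuclideanSpace ℝ (Fin n))} (hs : MeasurableSet s)
    (f : EuclideanSpace ℝ (Fin n) → ℝ) :
    ∫ x, f x * s.indicator (fun x => (w x)⁻¹) x ∂(weightMeasureBall w) =
      ∫ x in s, f x ∂(volume.restrict (ball 0 1)) := by
  rw [hw.integral_eq, ← integral_indicator hs]
  refine integral_congr_ae ?_
  filter_upwards [ae_restrict_of_ae hw.pos_ae] with x hx
  by_cases hxs : x ∈ s
  · simp only [Set.indicator_of_mem hxs]
    field_simp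
  · simp [Set.indicator_of_notMem hxs]

/-- Weakly convergent sequences in `H¹₀(B₁, w)` have subsequences that converge a.e. -/
theorem exists_subseq_ae_tendsto (hw : IsA2Weight w) {f : ℕ → EuclideanSpace ℝ (Fin n) → ℝ}
    {F : ℕ → EuclideanSpace ℝ (Fin n) → EuclideanSpace ℝ (Fin n)}
    (h : ∀ k, MemH10Pair w (f k) (F k)) (hv : MemH10Pair w v G) {R : ℝ≥0∞} (hR : R ≠ ⊤)
    (hf : ∀ k, eLpNorm (f k) 2 (weightMeasureBall w) ≤ R)
    (hF : ∀ k, eLpNorm (F k) 2 (weightMeasureBall w) ≤ R)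
    (hlim : ∀ η, MemLp η 2 (weightMeasureBall w) →
      Tendsto (fun k => ∫ x, f k x * η x ∂(weightMeasureBall w)) atTop
        (𝓝 (∫ x, v x * η x ∂(weightMeasureBall w)))) :
    ∃ ns : ℕ → ℕ, StrictMono ns ∧
      ∀ᵐ x ∂(weightMeasureBall w), Tendsto (fun k => f (ns k) x) atTop (𝓝 (v x)) := by
  have hsum : eLpNorm v 2 (weightMeasureBall w) + eLpNorm G 2 (weightMeasureBall w) ≠ ⊤ :=
    ENNReal.add_ne_top.2 ⟨hv.memLp.2.ne, hv.memLp_grad.2.ne⟩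
  have h1 := tendsto_eLpNorm_one_of_memH10Pair hw (fun k => (h k).sub hw hv)
    (R := R + (eLpNorm v 2 (weightMeasureBall w) + eLpNorm G 2 (weightMeasureBall w)))
    (ENNReal.add_ne_top.2 ⟨hR, hsum⟩)
    (fun k => (eLpNorm_sub_le (h k).memLp.1 hv.memLp.1 (by norm_num)).trans
      (add_le_add (hf k) le_self_add))
    (fun k => (eLpNorm_sub_le (h k).memLp_grad.1 hv.memLp_grad.1 (by norm_num)).trans
      (add_le_add (hF k) le_add_self))
    (fun s hs => by
      have h2 := hlim _ (hw.memLp_inv.indicator hs)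
      simp only [hw.integral_mul_indicator_inv hs] at h2
      have h3 : ∀ k, ∫ x in s, (f k x - v x) ∂(volume.restrict (ball 0 1)) =
          (∫ x in s, f k x ∂(volume.restrict (ball 0 1))) -
            ∫ x in s, v x ∂(volume.restrict (ball 0 1)) := fun k =>
        integral_sub (Integrable.integrableOn (hw.integrableOn (h k).memLp))
          (Integrable.integrableOn (hw.integrableOn hv.memLp))
      simp only [h3]
      simpa using h2.sub_const (∫ x in s, v x ∂(volume.restrict (ball 0 1))))
  rw [hw.ae_eq]
  exact (tendstoInMeasure_of_tendsto_eLpNorm one_ne_zero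
    (fun k => hw.aestronglyMeasurable_iff.1 (h k).memLp.1)
    (hw.aestronglyMeasurable_iff.1 hv.memLp.1) h1).exists_seq_tendsto_ae

/-- Lower semicontinuity of the penalty under a.e. convergence. -/
theorem penalty_le_of_ae_tendsto {α : Type*} [MeasurableSpace α] {μ : Measure α}
    [IsFiniteMeasure μ] (hε : 0 < ε) {u : ℕ → α → ℝ} {v : α → ℝ}
    (h : ∀ᵐ x ∂μ, Tendsto (fun k => u k x) atTop (𝓝 (v x))) {a : ℕ → ℝ} {A I : ℝ}
    (ha : Tendsto a atTop (𝓝 A)) {b : ℕ → ℝ} (hb : Tendsto b atTop (𝓝 I))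
    (hab : ∀ k, a k + penalty ε m (μ.real {x | 0 < u k x}) ≤ b k) :
    A + penalty ε m (μ.real {x | 0 < v x}) ≤ I := by
  -- `S k` is where every `u j`, `j ≥ k`, is positive. These sets increase, lie in `{u k > 0}`, and
  -- exhaust `{v > 0}` up to a null set, so continuity from below gives the bound.
  set S : ℕ → Set α := fun k => ⋂ j ≥ k, {x | 0 < u j x}
  have hSmono : Monotone S := fun k l hkl =>
    Set.biInter_subset_biInter_left fun j (hj : l ≤ j) => hkl.trans hj
  have h1 : μ.real {x | 0 < v x} ≤ μ.real (⋃ k, S k) := by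
    refine ENNReal.toReal_mono (measure_ne_top _ _) (measure_mono_ae ?_)
    filter_upwards [h] with x hx hx0
    obtain ⟨k, hk⟩ := eventually_atTop.1 (hx.eventually_const_lt (show 0 < v x from hx0))
    exact Set.mem_iUnion.2 ⟨k, Set.mem_iInter₂.2 hk⟩
  have h2 : Tendsto (fun k => μ.real (S k)) atTop (𝓝 (μ.real (⋃ k, S k))) :=
    (ENNReal.tendsto_toReal (measure_ne_top _ _)).comp (tendsto_measure_iUnion_atTop hSmono)
  have h3 := ha.add ((continuous_penalty (ε := ε) (m := m)).tendsto _ |>.comp h2)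
  refine (add_le_add le_rfl (penalty_mono hε h1)).trans (le_of_tendsto_of_tendsto' h3 hb fun k => ?_)
  refine le_trans (add_le_add le_rfl (penalty_mono hε (measureReal_mono ?_))) (hab k)
  exact Set.biInter_subset_of_mem (le_refl k)

theorem exists_isPenalizedMinimizer (hw : IsA2Weight w) (hn : 2 ≤ n)
    (hg : ContDiffOn ℝ ∞ g (closedBall 0 1))
    (hgpos : ∃ c : ℝ, 0 < c ∧ ∀ x ∈ sphere (0 : EuclideanSpace ℝ (Fin n)) 1, c ≤ g x)
    (hε : 0 < ε) :
    ∃ u, IsPenalizedMinimizer ε m w g u ∧ ∀ᵐ x ∂(weightMeasureBall w), 0 ≤ u x := by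
  have hfin := hw.isFiniteMeasure
  have hgL := memLp_of_contDiffOn hw hg
  have hgL' := memLp_gradient_of_contDiffOn hw hg
  set μ := weightMeasureBall w with hμ
  set 𝓢 : Set ℝ := penalizedEnergy ε m w '' {v | MemH1g w g v}
  have hne : 𝓢.Nonempty := by
    have h0 : MemH10Pair w (fun x => g x - g x) (fun x => ∇ g x - ∇ g x) := by
      simpa using memH10Pair_zero hw
    exact ⟨_, Set.mem_image_of_mem _ (h0.memH1g hw hg)⟩
  have hbdd : BddBelow 𝓢 := by
    refine ⟨0, ?_⟩
    rintro _ ⟨v, -, rfl⟩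
    rw [penalizedEnergy_eq hw EventuallyEq.rfl]
    exact add_nonneg (integral_nonneg fun x => by positivity) (penalty_nonneg hε _)
  obtain ⟨J, hJanti, hJ, hJmem⟩ := exists_seq_tendsto_sInf hne hbdd
  choose v hv hvJ using hJmem
  -- Clipping the minimizing sequence supplies the `L²(w)` bound on the functions directly, so no
  -- weighted Poincaré inequality is needed, and it makes the limit nonnegative.
  choose u G hpair hu01 hen using fun k =>
    (show MemH1g w g (v k) from hv k).exists_truncation (m := m) hw hn hg hgpos hε
  simp only [hvJ] at hen
  have huL : ∀ k, MemLp (u k) 2 μ := fun k => (hpair k).memLp_of_sub hw hg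
  have hGL : ∀ k, MemLp (G k) 2 μ := fun k => (hpair k).memLp_grad_of_sub hw hg
  have hGbd : ∀ k, ∫ x, ‖G k x‖ ^ 2 ∂μ ≤ J 0 := fun k =>
    (le_add_of_nonneg_right (penalty_nonneg hε _)).trans ((hen k).trans (hJanti (Nat.zero_le k)))
  obtain ⟨R, hR, hfR, hFR⟩ : ∃ R : ℝ≥0∞, R ≠ ⊤ ∧
      (∀ k, eLpNorm (fun x => u k x - g x) 2 μ ≤ R) ∧
      ∀ k, eLpNorm (fun x => G k x - ∇ g x) 2 μ ≤ R := by
    have hu2 : ∀ k, eLpNorm (u k) 2 μ ≤ eLpNorm (fun _ => boundarySup g) 2 μ := fun k =>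
      eLpNorm_mono fun x => by
        rw [Real.norm_of_nonneg (hu01 k x).1]
        exact (hu01 k x).2.trans (le_abs_self _)
    have hG2 : ∀ k, eLpNorm (G k) 2 μ ≤ ENNReal.ofReal (J 0 ^ (2 : ℝ)⁻¹) := fun k => by
      rw [(hGL k).eLpNorm_eq_integral_rpow_norm (by simp) (by simp)]
      simp only [ENNReal.toReal_ofNat, Real.rpow_ofNat]
      gcongr
      exact hGbd k
    have hM2 : eLpNorm (fun _ => boundarySup g) 2 μ ≠ ⊤ := (memLp_const _).2.ne
    refine ⟨(eLpNorm (fun _ => boundarySup g) 2 μ + eLpNorm g 2 μ) +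
      (ENNReal.ofReal (J 0 ^ (2 : ℝ)⁻¹) + eLpNorm (∇ g) 2 μ), ?_, fun k => ?_, fun k => ?_⟩
    · exact ENNReal.add_ne_top.2 ⟨ENNReal.add_ne_top.2 ⟨hM2, hgL.2.ne⟩,
        ENNReal.add_ne_top.2 ⟨ENNReal.ofReal_ne_top, hgL'.2.ne⟩⟩
    · exact ((eLpNorm_sub_le (huL k).1 hgL.1 (by norm_num)).trans
        (add_le_add (hu2 k) le_rfl)).trans le_self_add
    · exact ((eLpNorm_sub_le (hGL k).1 hgL'.1 (by norm_num)).trans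
        (add_le_add (hG2 k) le_rfl)).trans le_add_self
  obtain ⟨f, F, ns, hns, hfF, hweak, hweak'⟩ :=
    exists_subseq_tendsto_memH10Pair hw hpair hR hfR hFR
  obtain ⟨ms, hms, hae⟩ := exists_subseq_ae_tendsto hw (fun k => hpair (ns k)) hfF hR
    (fun k => hfR (ns k)) (fun k => hFR (ns k)) hweak
  set ks : ℕ → ℕ := fun k => ns (ms k)
  have hks : StrictMono ks := hns.comp hms
  have hFpair : MemH10Pair w (fun x => (f x + g x) - g x) (fun x => (F x + ∇ g x) - ∇ g x) := by
    simpa using hfF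
  have hHL : MemLp (fun x => F x + ∇ g x) 2 μ := hfF.memLp_grad.add hgL'
  have hae' : ∀ᵐ x ∂μ, Tendsto (fun k => u (ks k) x) atTop (𝓝 (f x + g x)) := by
    filter_upwards [hae] with x hx
    simpa using hx.add_const (g x)
  refine ⟨fun x => f x + g x, ⟨hFpair.memH1g hw hg, fun v' hv' => ?_⟩, ?_⟩
  · refine le_trans ?_ (csInf_le hbdd (Set.mem_image_of_mem _ hv'))
    rw [hFpair.penalizedEnergy_eq hw hg]
    have hcross : Tendsto (fun k => ∫ x, ⟪G (ks k) x - ∇ g x, F x + ∇ g x⟫ ∂μ) atTop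
        (𝓝 (∫ x, ⟪F x, F x + ∇ g x⟫ ∂μ)) := (hweak' _ hHL).comp hms.tendsto_atTop
    -- With `H = F + ∇g`, this is the linear lower bound `∫ |H|² + 2 ∫ ⟪Gₖ - H, H⟫ ≤ ∫ |Gₖ|²`, which
    -- follows from `|Gₖ - H|² ≥ 0`. It converges to `∫ |H|²` by weak convergence and plays the role
    -- of `a` in `penalty_le_of_ae_tendsto`.
    have ha : Tendsto (fun k => (∫ x, ‖F x + ∇ g x‖ ^ 2 ∂μ) +
        2 * ((∫ x, ⟪G (ks k) x - ∇ g x, F x + ∇ g x⟫ ∂μ) - ∫ x, ⟪F x, F x + ∇ g x⟫ ∂μ)) atTop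
        (𝓝 (∫ x, ‖F x + ∇ g x‖ ^ 2 ∂μ)) := by
      simpa using ((hcross.sub_const (∫ x, ⟪F x, F x + ∇ g x⟫ ∂μ)).const_mul 2).const_add
        (∫ x, ‖F x + ∇ g x‖ ^ 2 ∂μ)
    refine penalty_le_of_ae_tendsto hε hae' ha (hJ.comp hks.tendsto_atTop) fun k => ?_
    refine le_trans (add_le_add ?_ le_rfl) (hen (ks k))
    have hi1 := (hpair (ks k)).memLp_grad.integrable_inner_of_two hHL
    have hi2 := hfF.memLp_grad.integrable_inner_of_two hHL
    have hi : Integrable (fun x => 2 * (⟪G (ks k) x - ∇ g x, F x + ∇ g x⟫ -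
      ⟪F x, F x + ∇ g x⟫)) μ := (hi1.sub hi2).const_mul 2
    rw [← integral_sub hi1 hi2, ← integral_const_mul, ← integral_add hHL.integrable_norm_sq hi]
    refine integral_mono (hHL.integrable_norm_sq.add hi) (hGL (ks k)).integrable_norm_sq
      fun x => ?_
    have hsq := norm_sub_sq_real (G (ks k) x) (F x + ∇ g x)
    have hin : ⟪G (ks k) x - ∇ g x, F x + ∇ g x⟫ - ⟪F x, F x + ∇ g x⟫ =
        ⟪G (ks k) x, F x + ∇ g x⟫ - ‖F x + ∇ g x‖ ^ 2 := by
      rw [← inner_sub_left, ← real_inner_self_eq_norm_sq, ← inner_sub_left]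
      congr 1
      abel
    dsimp only
    rw [hin]
    nlinarith [sq_nonneg ‖G (ks k) x - (F x + ∇ g x)‖]
  · filter_upwards [hae'] with x hx
    exact ge_of_tendsto' hx fun k => (hu01 (ks k) x).1

end Existence

theorem lemma3p1 {n : ℕ} (hn : 2 ≤ n)
    (w : EuclideanSpace ℝ (Fin n) → ℝ) (hw : IsA2Weight w)
    (g : EuclideanSpace ℝ (Fin n) → ℝ) (hg : ContDiffOn ℝ ∞ g (closedBall 0 1))
    (hgpos : ∃ c : ℝ, 0 < c ∧ ∀ x ∈ sphere (0 : EuclideanSpace ℝ (Fin n)) 1, c ≤ g x)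
    (m : ℝ) (hm : 0 < m) (hmw : m < (weightMeasure w).real (ball 0 1))
    (ε : ℝ) (hε : 0 < ε) :
    (∃ u : EuclideanSpace ℝ (Fin n) → ℝ, IsPenalizedMinimizer ε m w g u ∧
      ∀ᵐ x ∂(volume.restrict (ball 0 1)), 0 ≤ u x) ∧
    (∀ u : EuclideanSpace ℝ (Fin n) → ℝ, IsPenalizedMinimizer ε m w g u →
      (∀ᵐ x ∂(volume.restrict (ball 0 1)), 0 ≤ u x) →
      IsWeakSubsolution w u ∧
        ∀ᵐ x ∂(volume.restrict (ball 0 1)), 0 ≤ u x ∧ u x ≤ boundarySup g) := by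
  rw [← hw.ae_eq]
  refine ⟨exists_isPenalizedMinimizer hw hn hg hgpos hε, fun u hu hu0 => ?_⟩
  have hsub := hu.isWeakSubsolution hw hg hε
  exact ⟨hsub, hu0.and (hsub.le_boundarySup hw hn hg hu.1)⟩
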